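/- Let $\mathbb K$ be an algebraically closed field of characteristic zero, let $V$ be a $\mathbb K$-vector space of dimension $n+1$, let $0\le k\le n$, and let $\mathbb G(k,n)$ be the Grassmannian of $(k+1)$-dimensional linear subspaces $\Lambda$ of $V^*$, with its structure of projective variety given by the Plücker embedding. Let $\mathcal Q^\vee=\{(v,\Lambda)\in V^*\times\mathbb G(k,n)\mid v\in\Lambda\}$ be the universal subbundle of rank $k+1$, let $\mathcal Q$ be its dual, and let $\mathcal O(1)$ be the hyperplane bundle of the Plücker embedding; write $E(d)=E\otimes\mathcal O(1)^{\otimes d}$. For a Young diagram $\nu$ with $m$ boxes and a vector bundle $E$, let $\mathbb S_\nu E$ be the Schur functor of $\nu$ applied to $E$, that is, the image of the Young symmetrizer $c_\nu=a_\nu b_\nu$ (row symmetrizer times signed column symmetrizer) acting on $E^{\otimes m}$ by permutation of the factors. Let $\lambda=(\lambda_1\ge\lambda_2\ge\dots\ge\lambda_{k+1}\ge 0)$ be a Young diagram with at most $k+1$ rows and with $\lambda_1$ columns, and let $\alpha$ be the complement of $\lambda$ in the $(k+1)\times\lambda_1$ rectangle, rotated by a half turn so that it is again a Young diagram; that is,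 $\alpha_i=\lambda_1-\lambda_{k+2-i}$ for $1\le i\le k+1$. Then there is an isomorphism of algebraic vector bundles on $\mathbb G(k,n)$ $$\mathbb S_\lambda\mathcal Q^\vee(\lambda_1)\;\cong\;\mathbb S_\alpha\mathcal Q .$$ -/

import Mathlib

open TensorProduct TopologicalSpace

universe u v w

namespace GrassSchur

noncomputable section

/-! ### Spaces with functions and algebraic vector bundles -/

/-- A space with functions over `K`: a topological space with a sheaf of `K`-algebras of
`K`-valued functions (the regular functions), such that nonvanishing loci are open and inverses of
nowhere vanishing regular functions are regular.  Classical varieties are spaces of this kind. -/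
class SpaceWithFunctions (K : Type u) (X : Type v) [Field K] [TopologicalSpace X] where
  /-- The algebra of regular functions on an open set. -/
  regular : (U : Opens X) → Subalgebra K (U → K)
  restrict : ∀ {U W : Opens X} (h : W ≤ U) {f : U → K}, f ∈ regular U →
    (fun y : W => f ⟨y, h y.2⟩) ∈ regular W
  glue : ∀ {U : Opens X} {f : U → K},
    (∀ x : U, ∃ (W : Opens X) (h : W ≤ U), (x : X) ∈ W ∧
      (fun y : W => f ⟨y, h y.2⟩) ∈ regular W) → f ∈ regular U
  isOpen_ne_zero : ∀ {U : Opens X} {f : U → K}, f ∈ regular U → IsOpen {x : U | f x ≠ 0}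
  inv_mem : ∀ {U : Opens X} {f : U → K}, f ∈ regular U → (∀ x, f x ≠ 0) →
    (fun x => (f x)⁻¹) ∈ regular U

open SpaceWithFunctions

theorem mem_left {X : Type v} [TopologicalSpace X] {U W : Opens X} (x : (U ⊓ W : Opens X)) :
    (x : X) ∈ U := x.2.1

theorem mem_right {X : Type v} [TopologicalSpace X] {U W : Opens X} (x : (U ⊓ W : Opens X)) :
    (x : X) ∈ W := x.2.2

/-- An algebraic vector bundle on a space with functions: a family of vector spaces, with an open
cover and linear trivializations over it with values in a fixed finite-dimensional vector space,
such that the matrix coefficients of all transition maps are regular. -/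
structure AlgVectorBundle (K : Type u) (X : Type v) [Field K] [TopologicalSpace X]
    [SpaceWithFunctions K X] where
  /-- The fibre over a point. -/
  Fiber : X → Type*
  [addCommGroupFiber : ∀ x, AddCommGroup (Fiber x)]
  [moduleFiber : ∀ x, Module K (Fiber x)]
  /-- The typical fibre. -/
  Model : Type*
  [addCommGroupModel : AddCommGroup Model]
  [moduleModel : Module K Model]
  [finiteModel : Module.Finite K Model]
  /-- The index set of the atlas. -/
  Index : Type*
  base : Index → Opens X
  exists_mem_base : ∀ x, ∃ i, x ∈ base i
  triv : ∀ (i : Index) (x : X), x ∈ base i → (Fiber x ≃ₗ[K] Model)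
  regular_transition : ∀ (i j : Index) (m : Model) (ξ : Module.Dual K Model),
    (fun x : (base i ⊓ base j : Opens X) =>
      ξ (triv j x (mem_right x) ((triv i x (mem_left x)).symm m))) ∈ regular (K := K) (base i ⊓ base j)

attribute [instance] AlgVectorBundle.addCommGroupFiber AlgVectorBundle.moduleFiber
  AlgVectorBundle.addCommGroupModel AlgVectorBundle.moduleModel AlgVectorBundle.finiteModel

section Regular

variable {K : Type u} {X : Type v} [Field K] [TopologicalSpace X] [SpaceWithFunctions K X]

theorem regular_multilinear {U : Opens X} {ι : Type*} [Finite ι]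
    {M : ι → Type*} [∀ i, AddCommGroup (M i)] [∀ i, Module K (M i)] [∀ i, Module.Finite K (M i)]
    (φ : MultilinearMap K M K) (f : ∀ i, U → M i)
    (hf : ∀ i (ξ : Module.Dual K (M i)), (fun x => ξ (f i x)) ∈ regular (K := K) U) :
    (fun x => φ fun i => f i x) ∈ regular (K := K) U := by
  classical
  have := Fintype.ofFinite ι
  let b := fun i => Module.finBasis K (M i)
  have key : (fun x => φ fun i => f i x) =
      ∑ r : (∀ i, Fin (Module.finrank K (M i))),
        (∏ i, fun x => (b i).coord (r i) (f i x)) * fun _ => φ fun i => b i (r i) := by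
    funext x
    have h : (fun i => f i x) = fun i => ∑ j, (b i).coord j (f i x) • b i j := by
      funext i
      exact ((b i).sum_repr (f i x)).symm
    rw [h, MultilinearMap.map_sum]
    simp only [MultilinearMap.map_smul_univ, Finset.sum_apply, Pi.mul_apply, Finset.prod_apply,
      smul_eq_mul]
  rw [key]
  refine Subalgebra.sum_mem _ fun r _ => Subalgebra.mul_mem _ (Subalgebra.prod_mem _ fun i _ => ?_)
    (Subalgebra.algebraMap_mem _ _)
  exact hf i _

theorem regular_bilinear {U : Opens X} {M N : Type*} [AddCommGroup M] [Module K M]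
    [Module.Finite K M] [AddCommGroup N] [Module K N] [Module.Finite K N]
    (φ : M →ₗ[K] N →ₗ[K] K) (f : U → M) (g : U → N)
    (hf : ∀ ξ : Module.Dual K M, (fun x => ξ (f x)) ∈ regular (K := K) U)
    (hg : ∀ ξ : Module.Dual K N, (fun x => ξ (g x)) ∈ regular (K := K) U) :
    (fun x => φ (f x) (g x)) ∈ regular (K := K) U := by
  let b := Module.finBasis K M
  have key : (fun x => φ (f x) (g x)) =
      ∑ i, (fun x => b.coord i (f x)) * fun x => φ (b i) (g x) := by
    funext x
    have h : φ (f x) = ∑ i, b.coord i (f x) • φ (b i) := by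
      conv_lhs => rw [← b.sum_repr (f x)]
      simp only [map_sum, map_smul, Module.Basis.coord_apply]
    rw [h]
    simp [Finset.sum_apply]
  rw [key]
  exact Subalgebra.sum_mem _ fun i _ => Subalgebra.mul_mem _ (hf _) (hg _)

end Regular

/-! ### Young diagrams and Schur functors -/

/-- The complement of `lam` in the rectangle with `r` rows and as many columns as `lam`, rotated by
a half turn so that it is again a Young diagram. -/
def rectComplement (lam : YoungDiagram) (r : ℕ) : YoungDiagram where
  cells := (Finset.range r ×ˢ Finset.range (lam.rowLen 0)).filter
    fun c => (r - 1 - c.1, lam.rowLen 0 - 1 - c.2) ∉ lam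
  isLowerSet := by
    rintro ⟨i, j⟩ ⟨i', j'⟩ h hc
    have h1 : i' ≤ i := h.1
    have h2 : j' ≤ j := h.2
    simp only [Finset.coe_filter, Finset.mem_product, Finset.mem_range, Set.mem_ofPred_eq] at hc ⊢
    refine ⟨⟨by omega, by omega⟩, fun hmem => hc.2 ?_⟩
    exact lam.up_left_mem (by omega) (by omega) hmem

/-- The action of permutations of `ι` on a tensor power indexed by `ι`, by permuting factors. -/
def permRep (K : Type u) [Field K] (ι : Type*) (M : Type*) [AddCommGroup M] [Module K M] :
    Representation K (Equiv.Perm ι) (⨂[K] _ : ι, M) where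
  toFun g := (PiTensorProduct.reindex K (fun _ : ι => M) g).toLinearMap
  map_one' := by
    ext m
    simp only [LinearMap.compMultilinearMap_apply, LinearEquiv.coe_coe,
      PiTensorProduct.reindex_tprod]
    rfl
  map_mul' g h := by
    ext m
    simp only [LinearMap.compMultilinearMap_apply, LinearEquiv.coe_coe,
      PiTensorProduct.reindex_tprod, Module.End.mul_apply]
    rfl

/-- The sum of all permutations of the boxes of `lam` that preserve each row. -/
def rowSymmetrizer (K : Type u) [Field K] (lam : YoungDiagram) :
    MonoidAlgebra K (Equiv.Perm lam.cells) :=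
  ∑ g ∈ Finset.univ.filter (fun g : Equiv.Perm lam.cells => ∀ c, (g c).1.1 = c.1.1),
    MonoidAlgebra.single g 1

/-- The signed sum of all permutations of the boxes of `lam` that preserve each column. -/
def colAntisymmetrizer (K : Type u) [Field K] (lam : YoungDiagram) :
    MonoidAlgebra K (Equiv.Perm lam.cells) :=
  ∑ g ∈ Finset.univ.filter (fun g : Equiv.Perm lam.cells => ∀ c, (g c).1.2 = c.1.2),
    MonoidAlgebra.single g ((Equiv.Perm.sign g : ℤ) : K)

/-- The Young symmetrizer of `lam`. -/
def youngSymmetrizer (K : Type u) [Field K] (lam : YoungDiagram) :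
    MonoidAlgebra K (Equiv.Perm lam.cells) :=
  rowSymmetrizer K lam * colAntisymmetrizer K lam

/-- The Schur functor of `lam` on vector spaces: the image of the Young symmetrizer on the tensor
power indexed by the boxes of `lam`. -/
def schurSpace (K : Type u) [Field K] (lam : YoungDiagram) (M : Type*) [AddCommGroup M]
    [Module K M] : Submodule K (⨂[K] _ : lam.cells, M) :=
  LinearMap.range ((permRep K lam.cells M).asAlgebraHom (youngSymmetrizer K lam))

theorem map_asAlgebraHom (K : Type u) [Field K] {ι : Type*} {M N : Type*}
    [AddCommGroup M] [Module K M] [AddCommGroup N] [Module K N] (f : M →ₗ[K] N)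
    (a : MonoidAlgebra K (Equiv.Perm ι)) (t : ⨂[K] _ : ι, M) :
    PiTensorProduct.map (fun _ => f) ((permRep K ι M).asAlgebraHom a t) =
      (permRep K ι N).asAlgebraHom a (PiTensorProduct.map (fun _ => f) t) := by
  induction a using MonoidAlgebra.induction_linear with
  | zero => simp
  | add a b ha hb => simp [ha, hb]
  | single g r =>
    simp only [Representation.asAlgebraHom_single, LinearMap.smul_apply, map_smul]
    congr 1
    exact PiTensorProduct.map_reindex (fun _ => f) g t

theorem map_schurSpace (K : Type u) [Field K] (lam : YoungDiagram) {M N : Type*}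
    [AddCommGroup M] [Module K M] [AddCommGroup N] [Module K N] (e : M ≃ₗ[K] N) :
    (schurSpace K lam M).map
        ((PiTensorProduct.congr fun _ : lam.cells => e).toLinearMap) = schurSpace K lam N := by
  have h : ∀ t, (PiTensorProduct.congr fun _ : lam.cells => e) t =
      PiTensorProduct.map (fun _ => e.toLinearMap) t := fun t => rfl
  ext t
  constructor
  · rintro ⟨_, ⟨s, rfl⟩, rfl⟩
    exact ⟨PiTensorProduct.map (fun _ => e.toLinearMap) s, (map_asAlgebraHom K _ _ s).symm⟩
  · rintro ⟨s, rfl⟩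
    refine ⟨_, ⟨(PiTensorProduct.congr fun _ : lam.cells => e).symm s, rfl⟩, ?_⟩
    refine (map_asAlgebraHom K _ _ _).trans ?_
    rw [← h, LinearEquiv.apply_symm_apply]

/-- The Schur functor of `lam` on isomorphisms. -/
def schurCongr (K : Type u) [Field K] (lam : YoungDiagram) {M N : Type*}
    [AddCommGroup M] [Module K M] [AddCommGroup N] [Module K N] (e : M ≃ₗ[K] N) :
    schurSpace K lam M ≃ₗ[K] schurSpace K lam N :=
  (PiTensorProduct.congr fun _ : lam.cells => e).ofSubmodules _ _ (map_schurSpace K lam e)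

/-! ### Operations on vector bundles -/

namespace AlgVectorBundle

variable {K : Type u} {X : Type v} [Field K] [TopologicalSpace X] [SpaceWithFunctions K X]

/-- An isomorphism of algebraic vector bundles: a family of linear isomorphisms of the fibres which,
together with its inverse, has regular matrix coefficients in the trivializations. -/
structure Iso (E F : AlgVectorBundle K X) where
  equiv : ∀ x, E.Fiber x ≃ₗ[K] F.Fiber x
  regular_hom : ∀ (i : E.Index) (j : F.Index) (m : E.Model) (ξ : Module.Dual K F.Model),
    (fun x : (E.base i ⊓ F.base j : Opens X) =>
      ξ (F.triv j x (mem_right x) (equiv x ((E.triv i x (mem_left x)).symm m)))) ∈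
        regular (K := K) (E.base i ⊓ F.base j)
  regular_inv : ∀ (i : E.Index) (j : F.Index) (m : F.Model) (ξ : Module.Dual K E.Model),
    (fun x : (E.base i ⊓ F.base j : Opens X) =>
      ξ (E.triv i x (mem_left x) ((equiv x).symm ((F.triv j x (mem_right x)).symm m)))) ∈
        regular (K := K) (E.base i ⊓ F.base j)

/-- The dual bundle. -/
def dual (E : AlgVectorBundle K X) : AlgVectorBundle K X where
  Fiber x := Module.Dual K (E.Fiber x)
  Model := Module.Dual K E.Model
  Index := E.Index
  base := E.base
  exists_mem_base := E.exists_mem_base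
  triv i x hx := (E.triv i x hx).symm.dualMap
  regular_transition i j m ξ := by
    obtain ⟨a, rfl⟩ := (Module.evalEquiv K E.Model).surjective ξ
    have := E.regular_transition j i a m
    exact restrict (U := E.base j ⊓ E.base i) (W := E.base i ⊓ E.base j)
      (le_of_eq (inf_comm _ _)) this

/-- The tensor product of two bundles. -/
def tensor (E F : AlgVectorBundle K X) : AlgVectorBundle K X where
  Fiber x := E.Fiber x ⊗[K] F.Fiber x
  Model := E.Model ⊗[K] F.Model
  Index := E.Index × F.Index
  base i := E.base i.1 ⊓ F.base i.2
  exists_mem_base x :=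
    let ⟨i, hi⟩ := E.exists_mem_base x
    let ⟨j, hj⟩ := F.exists_mem_base x
    ⟨(i, j), hi, hj⟩
  triv i x hx := TensorProduct.congr (E.triv i.1 x hx.1) (F.triv i.2 x hx.2)
  regular_transition i j m ξ := by
    induction m using TensorProduct.induction_on with
    | zero =>
      simp only [map_zero]
      exact Subalgebra.zero_mem _
    | add a b ha hb =>
      simp only [map_add]
      exact Subalgebra.add_mem _ ha hb
    | tmul a b =>
      refine regular_bilinear ((TensorProduct.mk K E.Model F.Model).compr₂ ξ) _ _
        (fun η => ?_) (fun η => ?_)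
      · exact restrict (U := E.base i.1 ⊓ E.base j.1)
          (inf_le_inf inf_le_left inf_le_left) (E.regular_transition i.1 j.1 a η)
      · exact restrict (U := F.base i.2 ⊓ F.base j.2)
          (inf_le_inf inf_le_right inf_le_right) (F.regular_transition i.2 j.2 b η)

theorem regular_tensorPower (E : AlgVectorBundle K X) (ι : Type*) [Finite ι] (i j : E.Index)
    (m : ⨂[K] _ : ι, E.Model) (ξ : Module.Dual K (⨂[K] _ : ι, E.Model)) :
    (fun x : (E.base i ⊓ E.base j : Opens X) =>
      ξ ((PiTensorProduct.congr fun _ : ι => E.triv j x (mem_right x))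
        ((PiTensorProduct.congr fun _ : ι => E.triv i x (mem_left x)).symm m))) ∈
          regular (K := K) (E.base i ⊓ E.base j) := by
  induction m using PiTensorProduct.induction_on with
  | smul_tprod r a =>
    have := regular_multilinear (ξ.compMultilinearMap (PiTensorProduct.tprod K))
      (fun (s : ι) (x : (E.base i ⊓ E.base j : Opens X)) =>
        E.triv j x (mem_right x) ((E.triv i x (mem_left x)).symm (a s)))
      (fun s η => E.regular_transition i j (a s) η)
    simpa [PiTensorProduct.congr_symm_tprod, PiTensorProduct.congr_tprod, Pi.smul_def] using
      Subalgebra.smul_mem _ this r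
  | add a b ha hb =>
    simp only [map_add]
    exact Subalgebra.add_mem _ ha hb

/-- The tensor power of a bundle with factors indexed by a finite set. -/
def tensorPower (E : AlgVectorBundle K X) (ι : Type*) [Finite ι] : AlgVectorBundle K X where
  Fiber x := ⨂[K] _ : ι, E.Fiber x
  Model := ⨂[K] _ : ι, E.Model
  Index := E.Index
  base := E.base
  exists_mem_base := E.exists_mem_base
  triv i x hx := PiTensorProduct.congr fun _ : ι => E.triv i x hx
  regular_transition := E.regular_tensorPower ι

/-- The Schur functor of `lam` applied to a bundle. -/
def schur (lam : YoungDiagram) (E : AlgVectorBundle K X) : AlgVectorBundle K X where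
  Fiber x := schurSpace K lam (E.Fiber x)
  Model := schurSpace K lam E.Model
  Index := E.Index
  base := E.base
  exists_mem_base := E.exists_mem_base
  triv i x hx := schurCongr K lam (E.triv i x hx)
  regular_transition i j m ξ := by
    obtain ⟨η, rfl⟩ := LinearMap.exists_extend ξ
    exact E.regular_tensorPower lam.cells i j m η

end AlgVectorBundle

/-! ### The Grassmannian -/

/-- The set of `(k+1)`-dimensional linear subspaces of a vector space `L`, equivalently of
`k`-dimensional linear subspaces of the projective space of lines in `L`. -/
@[ext]
structure Grassmannian (K : Type u) [Field K] (L : Type v) [AddCommGroup L] [Module K L]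
    (k : ℕ) where
  space : Submodule K L
  finrank_space : Module.finrank K space = k + 1

namespace Grassmannian

variable {K : Type u} [Field K] {L : Type v} [AddCommGroup L] [Module K L] {k : ℕ}

instance (Λ : Grassmannian K L k) : Module.Finite K Λ.space :=
  Module.finite_of_finrank_pos (by rw [Λ.finrank_space]; omega)

/-- Some basis of the subspace `Λ`. -/
def basis (Λ : Grassmannian K L k) : Module.Basis (Fin (k + 1)) K Λ.space :=
  Module.finBasisOfFinrankEq K Λ.space Λ.finrank_space

variable (K L k) in
/-- The space in whose projectivization the Grassmannian is embedded. -/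
abbrev PluckerSpace : Type _ := ⋀[K]^(k + 1) L

/-- A representative of the image of `Λ` under the Plücker embedding: the wedge product of a basis
of `Λ`. Another choice of the basis multiplies it by a nonzero scalar. -/
def pluckerVector (Λ : Grassmannian K L k) : PluckerSpace K L k :=
  exteriorPower.ιMulti K (k + 1) fun i => (Λ.basis i : L)

/-- The Plücker coordinate given by `k + 1` linear forms on `L`. -/
def coordForm (a : Fin (k + 1) → Module.Dual K L) : Module.Dual K (PluckerSpace K L k) :=
  exteriorPower.pairingDual K L (k + 1) (exteriorPower.ιMulti K (k + 1) a)

theorem coordForm_pluckerVector (a : Fin (k + 1) → Module.Dual K L) (Λ : Grassmannian K L k) :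
    coordForm a Λ.pluckerVector =
      (Matrix.of fun i j => a i (Λ.basis j : L)).det := by
  rw [← Matrix.det_transpose]
  simp only [coordForm, pluckerVector, exteriorPower.pairingDual_ιMulti_ιMulti]
  rfl

/-- The value of a polynomial on the Plücker space at the Plücker vector of `Λ`. -/
def evalPoly (P : MvPolynomial (Module.Dual K (PluckerSpace K L k)) K)
    (Λ : Grassmannian K L k) : K :=
  MvPolynomial.eval (fun ξ => ξ Λ.pluckerVector) P

/-- The Zariski topology: the open sets are the unions of nonvanishing loci of homogeneous
polynomials in the Plücker coordinates. -/
instance : TopologicalSpace (Grassmannian K L k) :=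
  generateFrom {U | ∃ (P : MvPolynomial (Module.Dual K (PluckerSpace K L k)) K) (d : ℕ),
    P.IsHomogeneous d ∧ U = {Λ | evalPoly P Λ ≠ 0}}

theorem isOpen_evalPoly_ne_zero {P : MvPolynomial (Module.Dual K (PluckerSpace K L k)) K} {d : ℕ}
    (hP : P.IsHomogeneous d) : IsOpen {Λ : Grassmannian K L k | evalPoly P Λ ≠ 0} :=
  isOpen_generateFrom_of_mem ⟨P, d, hP, rfl⟩

/-- A function on an open subset of the Grassmannian is regular if it is locally a quotient of two
homogeneous polynomials of the same degree in the Plücker coordinates. -/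
def IsRegular (U : Opens (Grassmannian K L k)) (f : U → K) : Prop :=
  ∀ x : U, ∃ (W : Opens (Grassmannian K L k)) (h : W ≤ U), (x : Grassmannian K L k) ∈ W ∧
    ∃ (d : ℕ) (P D : MvPolynomial (Module.Dual K (PluckerSpace K L k)) K),
      P.IsHomogeneous d ∧ D.IsHomogeneous d ∧
        ∀ y : W, evalPoly D (y : Grassmannian K L k) ≠ 0 ∧
          f ⟨y, h y.2⟩ = evalPoly P (y : Grassmannian K L k) / evalPoly D y

instance : SpaceWithFunctions K (Grassmannian K L k) where
  regular U :=
    { carrier := {f | IsRegular U f}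
      algebraMap_mem' := fun c x => ⟨U, le_rfl, x.2, 0, MvPolynomial.C c, MvPolynomial.C 1,
        MvPolynomial.isHomogeneous_C _ _, MvPolynomial.isHomogeneous_C _ _,
        fun y => by simp [evalPoly]⟩
      add_mem' := by
        intro f g hf hg x
        obtain ⟨W, h, hx, d, P, D, hP, hD, hW⟩ := hf x
        obtain ⟨W', h', hx', d', P', D', hP', hD', hW'⟩ := hg x
        refine ⟨W ⊓ W', inf_le_left.trans h, ⟨hx, hx'⟩, d + d', P * D' + D * P', D * D',
          (hP.mul hD').add (hD.mul hP'), hD.mul hD', fun y => ?_⟩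
        have h1 := hW ⟨y, y.2.1⟩
        have h2 := hW' ⟨y, y.2.2⟩
        simp only [evalPoly, map_mul, map_add, Pi.add_apply] at h1 h2 ⊢
        refine ⟨mul_ne_zero h1.1 h2.1, ?_⟩
        rw [h1.2, h2.2, div_add_div _ _ h1.1 h2.1]
      mul_mem' := by
        intro f g hf hg x
        obtain ⟨W, h, hx, d, P, D, hP, hD, hW⟩ := hf x
        obtain ⟨W', h', hx', d', P', D', hP', hD', hW'⟩ := hg x
        refine ⟨W ⊓ W', inf_le_left.trans h, ⟨hx, hx'⟩, d + d', P * P', D * D',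
          hP.mul hP', hD.mul hD', fun y => ?_⟩
        have h1 := hW ⟨y, y.2.1⟩
        have h2 := hW' ⟨y, y.2.2⟩
        simp only [evalPoly, map_mul, Pi.mul_apply] at h1 h2 ⊢
        refine ⟨mul_ne_zero h1.1 h2.1, ?_⟩
        rw [h1.2, h2.2, div_mul_div_comm] }
  restrict := by
    intro U U' hU f hf x
    obtain ⟨W, h, hx, d, P, D, hP, hD, hW⟩ := hf ⟨x, hU x.2⟩
    exact ⟨W ⊓ U', inf_le_right, ⟨hx, x.2⟩, d, P, D, hP, hD, fun y => hW ⟨y, y.2.1⟩⟩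
  glue := by
    intro U f hf x
    obtain ⟨U', hU, hx, hreg⟩ := hf x
    obtain ⟨W, h, hx, d, P, D, hP, hD, hW⟩ := hreg ⟨x, hx⟩
    exact ⟨W, h.trans hU, hx, d, P, D, hP, hD, hW⟩
  isOpen_ne_zero := by
    intro U f hf
    refine isOpen_iff_mem_nhds.2 fun x hx => ?_
    obtain ⟨W, h, hxW, d, P, D, hP, hD, hW⟩ := hf x
    have ho : IsOpen ((W : Set (Grassmannian K L k)) ∩ {Λ | evalPoly P Λ ≠ 0}) :=
      W.2.inter (isOpen_evalPoly_ne_zero hP)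
    have ho' := ho.preimage (continuous_subtype_val (p := fun y => y ∈ U))
    refine Filter.mem_of_superset (ho'.mem_nhds ⟨hxW, fun h0 => hx ?_⟩) ?_
    · have := (hW ⟨x, hxW⟩).2
      rw [h0, zero_div] at this
      exact this
    · rintro y ⟨hy, hy'⟩
      have := hW ⟨y, hy⟩
      change f y ≠ 0
      have h2 : f y = _ := this.2
      rw [h2]
      exact div_ne_zero hy' this.1
  inv_mem := by
    intro U f hf h0 x
    obtain ⟨W, h, hxW, d, P, D, hP, hD, hW⟩ := hf x
    refine ⟨W, h, hxW, d, D, P, hD, hP, fun y => ⟨fun hy => ?_, ?_⟩⟩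
    · have := (hW y).2
      rw [hy, zero_div] at this
      exact h0 _ this
    · change (f _)⁻¹ = _
      rw [(hW y).2, inv_div]

theorem isOpen_form_ne_zero (ξ : Module.Dual K (PluckerSpace K L k)) :
    IsOpen {Λ : Grassmannian K L k | ξ Λ.pluckerVector ≠ 0} := by
  simpa [evalPoly] using
    isOpen_evalPoly_ne_zero (K := K) (L := L) (k := k) (MvPolynomial.isHomogeneous_X K ξ)

/-- The affine open set where a Plücker coordinate does not vanish. -/
def formOpen (ξ : Module.Dual K (PluckerSpace K L k)) : Opens (Grassmannian K L k) :=
  ⟨{Λ | ξ Λ.pluckerVector ≠ 0}, isOpen_form_ne_zero ξ⟩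

theorem mem_formOpen {ξ : Module.Dual K (PluckerSpace K L k)} {Λ : Grassmannian K L k} :
    Λ ∈ formOpen ξ ↔ ξ Λ.pluckerVector ≠ 0 := Iff.rfl

theorem regular_form_div (U : Opens (Grassmannian K L k))
    (ξ η : Module.Dual K (PluckerSpace K L k)) (h : U ≤ formOpen ξ) :
    (fun x : U => η (x : Grassmannian K L k).pluckerVector / ξ (x : Grassmannian K L k).pluckerVector)
      ∈ SpaceWithFunctions.regular (K := K) U := fun x =>
  ⟨U, le_rfl, x.2, 1, MvPolynomial.X η, MvPolynomial.X ξ, MvPolynomial.isHomogeneous_X _ _,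
    MvPolynomial.isHomogeneous_X _ _, fun y => by simpa [evalPoly] using mem_formOpen.1 (h y.2)⟩

theorem exists_coordForm_ne_zero (Λ : Grassmannian K L k) :
    ∃ a : Fin (k + 1) → Module.Dual K L, coordForm a Λ.pluckerVector ≠ 0 := by
  choose a ha using fun i => LinearMap.exists_extend (Λ.basis.coord i)
  refine ⟨a, ?_⟩
  rw [coordForm_pluckerVector]
  have : (Matrix.of fun i j => a i (Λ.basis j : L)) = 1 := by
    ext i j
    have h := LinearMap.congr_fun (ha i) (Λ.basis j)
    simp only [LinearMap.comp_apply, Submodule.subtype_apply, Module.Basis.coord_apply,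
      Module.Basis.repr_self] at h
    simp only [Matrix.of_apply, h, Matrix.one_apply, Finsupp.single_apply, eq_comm]
  rw [this, Matrix.det_one]
  exact one_ne_zero

theorem pluckerVector_ne_zero (Λ : Grassmannian K L k) : Λ.pluckerVector ≠ 0 := by
  obtain ⟨a, ha⟩ := Λ.exists_coordForm_ne_zero
  exact fun h => ha (by rw [h, map_zero])

/-- Evaluation of `k + 1` linear forms on `L` at the vectors of `Λ`. -/
def evalMap (a : Fin (k + 1) → Module.Dual K L) (Λ : Grassmannian K L k) : Λ.space →ₗ[K] (Fin (k + 1) → K) :=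
  LinearMap.pi fun i => a i ∘ₗ Λ.space.subtype

theorem det_evalMap (a : Fin (k + 1) → Module.Dual K L) (Λ : Grassmannian K L k) :
    (LinearMap.toMatrix Λ.basis (Pi.basisFun K (Fin (k + 1))) (evalMap a Λ)).det =
      coordForm a Λ.pluckerVector := by
  rw [coordForm_pluckerVector]
  congr 1
  ext i j
  simp [LinearMap.toMatrix_apply, evalMap]

/-- Where the Plücker coordinate of `a` does not vanish, evaluation of `a` identifies `Λ` with the
standard vector space. -/
def evalEquiv (a : Fin (k + 1) → Module.Dual K L) (Λ : Grassmannian K L k)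
    (h : Λ ∈ formOpen (coordForm a)) : Λ.space ≃ₗ[K] (Fin (k + 1) → K) :=
  have hdet : IsUnit
      (LinearMap.toMatrix Λ.basis (Pi.basisFun K (Fin (k + 1))) (evalMap a Λ)).det := by
    rw [det_evalMap]
    exact isUnit_iff_ne_zero.2 (mem_formOpen.1 h)
  LinearEquiv.ofIsUnitDet hdet

theorem evalEquiv_apply (a : Fin (k + 1) → Module.Dual K L) (Λ : Grassmannian K L k)
    (h : Λ ∈ formOpen (coordForm a)) (l : Λ.space) (i : Fin (k + 1)) :
    evalEquiv a Λ h l i = a i (l : L) := rfl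

theorem evalEquiv_symm_apply (a : Fin (k + 1) → Module.Dual K L) (Λ : Grassmannian K L k)
    (h : Λ ∈ formOpen (coordForm a)) (j : Fin (k + 1)) (v : Module.Dual K L) :
    v (((evalEquiv a Λ h).symm (Pi.single j 1) : Λ.space) : L) =
      coordForm (Function.update a j v) Λ.pluckerVector / coordForm a Λ.pluckerVector := by
  rw [eq_div_iff (mem_formOpen.1 h), coordForm_pluckerVector, coordForm_pluckerVector, ← smul_eq_mul]
  set c : Fin (k + 1) → K := fun i =>
    v (((evalEquiv a Λ h).symm (Pi.single i 1) : Λ.space) : L) with hc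
  set A : Matrix (Fin (k + 1)) (Fin (k + 1)) K :=
    Matrix.of fun i j => a i (Λ.basis j : L) with hA
  have hexp : ∀ l : Λ.space, v (l : L) =
      ∑ i, c i * a i (l : L) := by
    intro l
    have h1 : l = ∑ i, a i (l : L) • (evalEquiv a Λ h).symm (Pi.single i 1) := by
      apply (evalEquiv a Λ h).injective
      simp only [map_sum, map_smul, LinearEquiv.apply_symm_apply]
      funext t
      simp [evalEquiv_apply, Finset.sum_apply, Pi.single_apply]
    conv_lhs => rw [h1]
    simp [hc, mul_comm]
  have hup : (Matrix.of fun i l => (Function.update a j v i) (Λ.basis l : L)) =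
      A.updateRow j (∑ i, c i • A i) := by
    ext i l
    by_cases hij : i = j
    · subst hij
      simp [hexp, hA, Finset.sum_apply]
    · simp [hij, hA]
  rw [hup, Matrix.det_updateRow_sum]

variable (K L k)

/-- The universal subbundle, of rank `k + 1`: its fibre over `Λ` is `Λ` itself. It is trivialized
by the evaluation of `k + 1` linear forms on `L`. -/
def universalSub : AlgVectorBundle K (Grassmannian K L k) where
  Fiber Λ := Λ.space
  Model := Fin (k + 1) → K
  Index := Fin (k + 1) → Module.Dual K L
  base a := formOpen (K := K) (coordForm a)
  exists_mem_base := exists_coordForm_ne_zero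
  triv a Λ h := evalEquiv a Λ h
  regular_transition a b m ξ := by
    have key : (fun x : (formOpen (K := K) (coordForm a) ⊓ formOpen (coordForm b) :
        Opens (Grassmannian K L k)) =>
          ξ (evalEquiv b x.1 (mem_right x) ((evalEquiv a x.1 (mem_left x)).symm m))) =
        ∑ j, ∑ i, (m j * ξ (Pi.single i 1)) • fun x =>
          coordForm (Function.update a j (b i)) (x.1 : Grassmannian K L k).pluckerVector /
            coordForm a (x.1 : Grassmannian K L k).pluckerVector := by
      funext x
      have hm : m = ∑ j, m j • (Pi.single j 1 : Fin (k + 1) → K) := by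
        funext t
        simp [Finset.sum_apply, Pi.single_apply]
      have hξ : ∀ q : Fin (k + 1) → K, ξ q = ∑ i, q i * ξ (Pi.single i 1) := by
        intro q
        rw [LinearMap.pi_apply_eq_sum_univ ξ q]
        refine Finset.sum_congr rfl fun i _ => ?_
        rw [smul_eq_mul]
        congr 2
        funext t
        simp [Pi.single_apply, eq_comm]
      conv_lhs => rw [hm]
      simp only [map_sum, map_smul, Finset.sum_apply, Pi.smul_apply, smul_eq_mul]
      refine Finset.sum_congr rfl fun j _ => ?_
      rw [hξ, Finset.mul_sum]
      refine Finset.sum_congr rfl fun i _ => ?_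
      rw [evalEquiv_apply, evalEquiv_symm_apply]
      ring
    change _ ∈ SpaceWithFunctions.regular _
    rw [key]
    exact Subalgebra.sum_mem _ fun j _ => Subalgebra.sum_mem _ fun i _ =>
      Subalgebra.smul_mem _ (regular_form_div _ _ _ inf_le_left) _

/-- The universal quotient bundle, the dual of the universal subbundle. -/
def universalQuot : AlgVectorBundle K (Grassmannian K L k) := (universalSub K L k).dual

variable {K L k} in
/-- A linear form on the Plücker space that does not vanish at `Λ` identifies the line of `Λ`
with `K`. -/
def lineEquiv (ξ : Module.Dual K (PluckerSpace K L k)) (Λ : Grassmannian K L k)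
    (h : Λ ∈ formOpen ξ) : (K ∙ Λ.pluckerVector) ≃ₗ[K] K :=
  LinearEquiv.ofBijective (ξ ∘ₗ (K ∙ Λ.pluckerVector).subtype) <| by
    constructor
    · refine (injective_iff_map_eq_zero _).2 ?_
      rintro ⟨y, hy⟩ h0
      obtain ⟨c, rfl⟩ := Submodule.mem_span_singleton.1 hy
      have h1 : c * ξ Λ.pluckerVector = 0 := by simpa using h0
      have h2 : c = 0 := (mul_eq_zero.1 h1).resolve_right (mem_formOpen.1 h)
      simp [h2]
    · intro c
      refine ⟨⟨(c / ξ Λ.pluckerVector) • Λ.pluckerVector,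
        Submodule.smul_mem _ _ (Submodule.mem_span_singleton_self _)⟩, ?_⟩
      simp [mem_formOpen.1 h]

variable {K L k} in
theorem lineEquiv_apply (ξ : Module.Dual K (PluckerSpace K L k)) (Λ : Grassmannian K L k)
    (h : Λ ∈ formOpen ξ) (y : (K ∙ Λ.pluckerVector)) : lineEquiv ξ Λ h y = ξ y := rfl

variable {K L k} in
theorem lineEquiv_symm_apply (ξ : Module.Dual K (PluckerSpace K L k)) (Λ : Grassmannian K L k)
    (h : Λ ∈ formOpen ξ) (c : K) :
    (((lineEquiv ξ Λ h).symm c : (K ∙ Λ.pluckerVector)) : PluckerSpace K L k) =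
      (c / ξ Λ.pluckerVector) • Λ.pluckerVector := by
  have : (lineEquiv ξ Λ h).symm c = ⟨(c / ξ Λ.pluckerVector) • Λ.pluckerVector,
      Submodule.smul_mem _ _ (Submodule.mem_span_singleton_self _)⟩ := by
    rw [LinearEquiv.symm_apply_eq, lineEquiv_apply]
    simp [mem_formOpen.1 h]
  rw [this]

/-- The line bundle `𝒪(-1)`: its fibre over `Λ` is the line in the Plücker space that is the image
of `Λ` under the Plücker embedding. -/
def tautLine : AlgVectorBundle K (Grassmannian K L k) where
  Fiber Λ := K ∙ Λ.pluckerVector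
  Model := K
  Index := Module.Dual K (PluckerSpace K L k)
  base := formOpen
  exists_mem_base Λ :=
    let ⟨a, ha⟩ := Λ.exists_coordForm_ne_zero
    ⟨coordForm a, ha⟩
  triv ξ Λ h := lineEquiv ξ Λ h
  regular_transition ξ η m φ := by
    have key : (fun x : (formOpen ξ ⊓ formOpen η : Opens (Grassmannian K L k)) =>
          φ (lineEquiv η x.1 (mem_right x) ((lineEquiv ξ x.1 (mem_left x)).symm m))) =
        (m * φ 1) • fun x => η (x.1 : Grassmannian K L k).pluckerVector /
            ξ (x.1 : Grassmannian K L k).pluckerVector := by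
      funext x
      have hφ : ∀ q : K, φ q = q * φ 1 := fun q => by
        rw [← smul_eq_mul, ← map_smul, smul_eq_mul, mul_one]
      rw [hφ, lineEquiv_apply, lineEquiv_symm_apply, map_smul]
      simp only [Pi.smul_apply, smul_eq_mul]
      ring
    change _ ∈ SpaceWithFunctions.regular _
    rw [key]
    exact Subalgebra.smul_mem _ (regular_form_div _ _ _ inf_le_left) _

/-- The line bundle `𝒪(d)`, the `d`-th tensor power of the dual of the tautological line bundle. -/
def twistingLine (d : ℕ) : AlgVectorBundle K (Grassmannian K L k) :=
  (tautLine K L k).dual.tensorPower (Fin d)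

end Grassmannian

/-- The twist of a vector bundle on the Grassmannian by `𝒪(d)`. -/
def AlgVectorBundle.twist {K : Type u} [Field K] {L : Type v} [AddCommGroup L] [Module K L] {k : ℕ}
    (E : AlgVectorBundle K (Grassmannian K L k)) (d : ℕ) :
    AlgVectorBundle K (Grassmannian K L k) :=
  E.tensor (Grassmannian.twistingLine K L k d)

end

end GrassSchur

/-! Put r = k + 1, W = K^r and N = λ₁. On fibres the claim is S_λ W ≅ S_α W* ⊗ det^N as
representations of GL(W); an explicit isomorphism is built, without highest weights.

The boxes of λ and α together fill the r × N rectangle. The product of the volume forms of its N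
columns is an integral kernel, hence a map D : W^{⊗λ} → (W*)^{⊗α} with gᵀ D g = det(g)^N D
(`map_dualMap_kernelMap`), alternating along columns on both sides. Let a, b and a', b' be the row
symmetrizers and column antisymmetrizers of λ and α. Since b' D and D are proportional, F = a' D
lands in the image of c_α = a' b'; likewise G = a Dᵀ lands in the image of c_λ = a b.

In GF = a (Dᵀ a' D) the bracket is the action of a group algebra element: a product of two
determinants is a signed sum over permutations within columns, and summing out the indices on α
turns each of them into a multiple of a permutation of the boxes of λ (`exists_sum_detKernel_mul`).
As D absorbs b up to a factor, the classical fact that a x b is a multiple of c_λ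
(`exists_rowSymmetrizer_mul_mul`) gives GF = u c_λ. Here u ≠ 0, because a diagonal coefficient of GF
is a positive multiple of a sum of integer squares that do not all vanish. Since c_λ² = h c_λ with h
≠ 0, GF is a nonzero scalar on S_λ W; by symmetry so is FG on S_α W*.

On the Grassmannian, two evaluation charts of the subbundle differ by a matrix whose determinant is
a ratio of Plücker coordinates, and 𝒪(1) changes by the inverse ratio. Twisting by 𝒪(N) thus cancels
det^N, and the single isomorphism F of typical fibres glues
(`AlgVectorBundle.nonempty_iso_of_model`). -/

set_option linter.unusedSectionVars false

namespace GrassSchur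

noncomputable section

/-! ### Symmetrizers of the fibres of a map -/

section FiberSymmetrizers

variable (K : Type*) [Field K] {ι κ : Type*} [Fintype ι] [DecidableEq ι] [DecidableEq κ]

/-- The sum of all permutations preserving the fibres of `f`. -/
def fiberSymmetrizer (f : ι → κ) : MonoidAlgebra K (Equiv.Perm ι) :=
  ∑ g ∈ Finset.univ.filter (fun g : Equiv.Perm ι => ∀ c, f (g c) = f c), MonoidAlgebra.single g 1

/-- The signed sum of all permutations preserving the fibres of `f`. -/
def fiberAntisymmetrizer (f : ι → κ) : MonoidAlgebra K (Equiv.Perm ι) :=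
  ∑ g ∈ Finset.univ.filter (fun g : Equiv.Perm ι => ∀ c, f (g c) = f c),
    MonoidAlgebra.single g ((Equiv.Perm.sign g : ℤ) : K)

/-- The number of permutations preserving the fibres of `f`. -/
def fiberPermCount (f : ι → κ) : ℕ :=
  (Finset.univ.filter (fun g : Equiv.Perm ι => ∀ c, f (g c) = f c)).card

theorem fiberPermCount_pos (f : ι → κ) : 0 < fiberPermCount f :=
  Finset.card_pos.2 ⟨1, by simp⟩

/-- Only the partition into fibres matters. Rows and columns of both diagrams can therefore be read
off from positions in the common rectangle. -/
theorem fiberSymmetrizer_congr {κ' : Type*} [DecidableEq κ'] {f : ι → κ} {f' : ι → κ'}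
    (h : ∀ c d, f c = f d ↔ f' c = f' d) : fiberSymmetrizer K f = fiberSymmetrizer K f' := by
  unfold fiberSymmetrizer
  congr 1
  ext g
  simp only [Finset.mem_filter, h]

theorem fiberAntisymmetrizer_congr {κ' : Type*} [DecidableEq κ'] {f : ι → κ} {f' : ι → κ'}
    (h : ∀ c d, f c = f d ↔ f' c = f' d) :
    fiberAntisymmetrizer K f = fiberAntisymmetrizer K f' := by
  unfold fiberAntisymmetrizer
  congr 1
  ext g
  simp only [Finset.mem_filter, h]

variable {K}

theorem fiberSymmetrizer_mul_single (f : ι → κ) {p : Equiv.Perm ι} (hp : ∀ c, f (p c) = f c) :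
    fiberSymmetrizer K f * MonoidAlgebra.single p 1 = fiberSymmetrizer K f := by
  unfold fiberSymmetrizer
  rw [Finset.sum_mul]
  simp only [MonoidAlgebra.single_mul_single, mul_one]
  refine Finset.sum_nbij' (fun g => g * p) (fun g => g * p⁻¹) ?_ ?_ ?_ ?_ ?_
  · intro g hg
    simp only [Finset.mem_filter, Finset.mem_univ, true_and] at hg ⊢
    intro c
    rw [Equiv.Perm.mul_apply, hg, hp]
  · intro g hg
    simp only [Finset.mem_filter, Finset.mem_univ, true_and] at hg ⊢
    intro c
    rw [Equiv.Perm.mul_apply, hg, ← hp, Equiv.Perm.inv_def, Equiv.apply_symm_apply]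
  · simp
  · simp
  · simp

theorem single_mul_fiberAntisymmetrizer (f : ι → κ) {p : Equiv.Perm ι}
    (hp : ∀ c, f (p c) = f c) :
    MonoidAlgebra.single p 1 * fiberAntisymmetrizer K f =
      ((Equiv.Perm.sign p : ℤ) : K) • fiberAntisymmetrizer K f := by
  unfold fiberAntisymmetrizer
  rw [Finset.mul_sum, Finset.smul_sum]
  simp only [MonoidAlgebra.single_mul_single, one_mul, MonoidAlgebra.smul_single, smul_eq_mul]
  have hs : ((Equiv.Perm.sign p : ℤ) : K) * ((Equiv.Perm.sign p : ℤ) : K) = 1 := by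
    rw [← Int.cast_mul, Int.units_coe_mul_self, Int.cast_one]
  refine Finset.sum_nbij' (fun g => p * g) (fun g => p⁻¹ * g) ?_ ?_ ?_ ?_ ?_
  · intro g hg
    simp only [Finset.mem_filter, Finset.mem_univ, true_and] at hg ⊢
    intro c
    rw [Equiv.Perm.mul_apply, hp, hg]
  · intro g hg
    simp only [Finset.mem_filter, Finset.mem_univ, true_and] at hg ⊢
    intro c
    rw [Equiv.Perm.mul_apply, ← hp, Equiv.Perm.inv_def, Equiv.apply_symm_apply, hg]
  · simp
  · simp
  · intro g _
    simp only [Equiv.Perm.sign_mul, Units.val_mul, Int.cast_mul, ← mul_assoc, hs, one_mul]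

/-- In the regular representation the diagonal entry at `g` is the coefficient of `x * g` at `g`,
that is, of `x` at 1, for every `g`. -/
theorem trace_mulLeft_monoidAlgebra {G : Type*} [Group G] [Fintype G] (x : MonoidAlgebra K G) :
    LinearMap.trace K _ (LinearMap.mulLeft K x) = Fintype.card G * x.coeff 1 := by
  classical
  rw [LinearMap.trace_eq_matrix_trace K (MonoidAlgebra.basis G K), Matrix.trace]
  have : ∀ g : G, (LinearMap.toMatrix (MonoidAlgebra.basis G K) (MonoidAlgebra.basis G K)
      (LinearMap.mulLeft K x)).diag g = x.coeff 1 := by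
    intro g
    rw [Matrix.diag_apply, LinearMap.toMatrix_apply, MonoidAlgebra.basis_apply,
      LinearMap.mulLeft_apply]
    change (x * MonoidAlgebra.single g 1).coeff g = _
    rw [MonoidAlgebra.coeff_mul_single_eq_coeff_mul (m₂ := 1) (H := by simp), mul_one]
  rw [Finset.sum_congr rfl fun g _ => this g, Finset.sum_const, Finset.card_univ, nsmul_eq_mul]

/-- A quasi-idempotent of a group algebra whose coefficient at the identity does not vanish is not
nilpotent. -/
theorem ne_zero_of_mul_self_eq_smul [CharZero K] {G : Type*} [Group G] [Finite G]
    {x : MonoidAlgebra K G} (hx : x.coeff 1 ≠ 0) {h : K} (hh : x * x = h • x) : h ≠ 0 := by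
  rintro rfl
  have := Fintype.ofFinite G
  -- With factor 0 the element squares to zero, so left multiplication by it has trace 0; but this
  -- trace is the group order times the coefficient at 1.
  have hn : IsNilpotent (LinearMap.mulLeft K x) := ⟨2, by
    rw [pow_two, Module.End.mul_eq_comp, ← LinearMap.mulLeft_mul, hh, zero_smul,
      LinearMap.mulLeft_zero_eq_zero]⟩
  have h0 := (LinearMap.isNilpotent_trace_of_isNilpotent hn).eq_zero
  rw [trace_mulLeft_monoidAlgebra] at h0
  exact mul_ne_zero (Nat.cast_ne_zero.2 Fintype.card_ne_zero) hx h0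

/-- If `p * q = 1`, then `p` preserves the fibres of both maps, hence fixes every point; only the
pair of identities contributes. -/
theorem coeff_one_fiberSymmetrizer_mul_fiberAntisymmetrizer {κ' : Type*} [DecidableEq κ']
    (f : ι → κ) (f' : ι → κ') (hinj : ∀ c d, f c = f d → f' c = f' d → c = d) :
    (fiberSymmetrizer K f * fiberAntisymmetrizer K f').coeff 1 = 1 := by
  unfold fiberSymmetrizer fiberAntisymmetrizer
  simp only [Finset.sum_mul_sum, MonoidAlgebra.single_mul_single, one_mul,
    MonoidAlgebra.coeff_sum, Finsupp.finsetSum_apply, MonoidAlgebra.coeff_single, Finsupp.single_apply]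
  rw [Finset.sum_eq_single_of_mem 1 (by simp), Finset.sum_eq_single_of_mem 1 (by simp)]
  · simp
  · intro q _ hq
    rw [one_mul, if_neg hq]
  · intro p hp hp1
    refine Finset.sum_eq_zero fun q hq => if_neg fun hpq => hp1 ?_
    simp only [Finset.mem_filter, Finset.mem_univ, true_and] at hp hq
    obtain rfl : p = q⁻¹ := eq_inv_of_mul_eq_one_left hpq
    ext c
    exact hinj _ _ (hp c) (by rw [← hq, Equiv.Perm.inv_def, Equiv.apply_symm_apply]; rfl)

end FiberSymmetrizers

/-! ### Young symmetrizers -/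

section Young

variable {K : Type u} [Field K] (lam : YoungDiagram)

/-- A column is an initial segment of rows. Summed over columns, these minima count the boxes in the
first `m` rows. -/
theorem card_col_row_lt (j m : ℕ) :
    (Finset.univ.filter fun w : lam.cells => w.1.2 = j ∧ w.1.1 < m).card =
      min (lam.colLen j) m := by
  rw [← Finset.card_range (min (lam.colLen j) m)]
  refine Finset.card_bij (fun w _ => w.1.1) ?_ ?_ ?_
  · rintro ⟨⟨a, b⟩, hw⟩ h
    simp only [Finset.mem_filter, Finset.mem_univ, true_and, Finset.mem_range, lt_min_iff] at h ⊢
    obtain ⟨rfl, h⟩ := h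
    exact ⟨YoungDiagram.mem_iff_lt_colLen.1 ((lam.mem_cells _).1 hw), h⟩
  · rintro ⟨⟨a, b⟩, hw⟩ h ⟨⟨a', b'⟩, hw'⟩ h' e
    simp only [Finset.mem_filter, Finset.mem_univ, true_and] at h h' e
    simp [h.1, h'.1, e]
  · intro i hi
    rw [Finset.mem_range, lt_min_iff] at hi
    exact ⟨⟨(i, j), (lam.mem_cells _).2 (YoungDiagram.mem_iff_lt_colLen.2 hi.1)⟩,
      by simp [hi.2], rfl⟩

/-- A permutation of the boxes that sends no two boxes of one column to one row sends every box
to a row that meets its column. -/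
theorem mem_of_injective_row_col (g : Equiv.Perm lam.cells)
    (hg : ∀ w w' : lam.cells, (g w).1.1 = (g w').1.1 → w.1.2 = w'.1.2 → w = w')
    (w : lam.cells) : ((g w).1.1, w.1.2) ∈ lam := by
  -- The boxes that `g` sends into the first `m` rows are counted column by column. Each column
  -- obeys an upper bound, and the bounds add up to the exact total, so all of them are attained.
  set m := lam.colLen w.1.2 with hm
  have hle : ∀ j, (Finset.univ.filter fun w : lam.cells => w.1.2 = j ∧ (g w).1.1 < m).card ≤
      min (lam.colLen j) m := by
    intro j
    refine le_min ?_ ?_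
    · have h1 := card_col_row_lt lam j (lam.colLen j)
      rw [min_self] at h1
      rw [← h1]
      refine Finset.card_le_card fun w hw => ?_
      simp only [Finset.mem_filter, Finset.mem_univ, true_and] at hw ⊢
      refine ⟨hw.1, ?_⟩
      rw [← hw.1]
      exact YoungDiagram.mem_iff_lt_colLen.1 ((lam.mem_cells _).1 w.2)
    · conv_rhs => rw [← Finset.card_range m]
      refine Finset.card_le_card_of_injOn (fun w => (g w).1.1) ?_ ?_
      · intro w hw
        simpa using (Finset.mem_filter.1 hw).2.2
      · intro w hw w' hw' e
        exact hg w w' e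
          ((Finset.mem_filter.1 hw).2.1.trans (Finset.mem_filter.1 hw').2.1.symm)
  have hfib : ∀ f : lam.cells → ℕ, (Finset.univ.filter fun w : lam.cells => f w < m).card =
      ∑ j ∈ Finset.univ.image (fun w : lam.cells => w.1.2),
        (Finset.univ.filter fun w : lam.cells => w.1.2 = j ∧ f w < m).card := by
    intro f
    rw [Finset.card_eq_sum_card_fiberwise (f := fun w : lam.cells => w.1.2)
      (t := Finset.univ.image (fun w : lam.cells => w.1.2)) (fun w _ => by simp)]
    refine Finset.sum_congr rfl fun j _ => ?_
    rw [Finset.filter_filter]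
    simp only [and_comm]
  -- As `g` is a bijection, the boxes sent into the first `m` rows are as many as the boxes there.
  have hsum : (Finset.univ.filter fun w : lam.cells => (g w).1.1 < m).card =
      (Finset.univ.filter fun w : lam.cells => w.1.1 < m).card :=
    Finset.card_bij (fun w _ => g w) (by simp) (by simp)
      (fun b hb => ⟨g.symm b, by simpa using hb, by simp⟩)
  rw [hfib (fun w => (g w).1.1), hfib (fun w => w.1.1)] at hsum
  simp only [card_col_row_lt] at hsum
  have heq := (Finset.sum_eq_sum_iff_of_le fun j _ => hle j).1 hsum w.1.2 (by simp)
  rw [← hm, min_self] at heq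
  have hcol := card_col_row_lt lam w.1.2 m
  rw [← hm, min_self] at hcol
  -- The column of `w` has length exactly `m`, so equality of counts means that all of its boxes are
  -- sent into the first `m` rows.
  have hsub : (Finset.univ.filter fun w' : lam.cells => w'.1.2 = w.1.2 ∧ (g w').1.1 < m) =
      Finset.univ.filter fun w' : lam.cells => w'.1.2 = w.1.2 ∧ w'.1.1 < m := by
    refine Finset.eq_of_subset_of_card_le (fun w' hw' => ?_) (by rw [heq, hcol])
    simp only [Finset.mem_filter, Finset.mem_univ, true_and] at hw' ⊢
    refine ⟨hw'.1, ?_⟩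
    rw [hm, ← hw'.1]
    exact YoungDiagram.mem_iff_lt_colLen.1 ((lam.mem_cells _).1 w'.2)
  have hw : w ∈ Finset.univ.filter fun w' : lam.cells => w'.1.2 = w.1.2 ∧ w'.1.1 < m := by
    simp only [Finset.mem_filter, Finset.mem_univ, true_and]
    exact YoungDiagram.mem_iff_lt_colLen.1 ((lam.mem_cells _).1 w.2)
  rw [← hsub] at hw
  exact YoungDiagram.mem_iff_lt_colLen.2 (Finset.mem_filter.1 hw).2.2

/-- Moving each box within its column to the row of its image stays inside the diagram by the
previous lemma, and is injective by hypothesis. Then `g * q⁻¹` preserves rows, so `g` is a row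
permutation times a column permutation. -/
theorem exists_col_perm (g : Equiv.Perm lam.cells)
    (hg : ∀ w w' : lam.cells, (g w).1.1 = (g w').1.1 → w.1.2 = w'.1.2 → w = w') :
    ∃ q : Equiv.Perm lam.cells, (∀ w, (q w).1.2 = w.1.2) ∧ ∀ w, (q w).1.1 = (g w).1.1 := by
  let f : lam.cells → lam.cells := fun w =>
    ⟨((g w).1.1, w.1.2), (lam.mem_cells _).2 (mem_of_injective_row_col lam g hg w)⟩
  have hf : Function.Injective f := fun w w' h => by
    have h' := Subtype.ext_iff.1 h
    exact hg w w' (Prod.ext_iff.1 h').1 (Prod.ext_iff.1 h').2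
  exact ⟨Equiv.ofBijective f (Finite.injective_iff_bijective.1 hf), fun _ => rfl, fun _ => rfl⟩

theorem rowSymmetrizer_eq : rowSymmetrizer K lam = fiberSymmetrizer K fun c => c.1.1 := rfl

theorem colAntisymmetrizer_eq :
    colAntisymmetrizer K lam = fiberAntisymmetrizer K fun c => c.1.2 := rfl

variable [CharZero K]

/-- The row symmetrizer times any element times the column antisymmetrizer is a multiple of the
Young symmetrizer. -/
theorem exists_rowSymmetrizer_mul_mul (x : MonoidAlgebra K (Equiv.Perm lam.cells)) :
    ∃ t : K, rowSymmetrizer K lam * x * colAntisymmetrizer K lam =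
      t • youngSymmetrizer K lam := by
  induction x using MonoidAlgebra.induction_linear with
  | zero => exact ⟨0, by simp⟩
  | add a b ha hb =>
    obtain ⟨s, hs⟩ := ha
    obtain ⟨t, ht⟩ := hb
    exact ⟨s + t, by rw [mul_add, add_mul, hs, ht, add_smul]⟩
  | single g r =>
    have hr : (MonoidAlgebra.single g r : MonoidAlgebra K (Equiv.Perm lam.cells)) =
        r • MonoidAlgebra.single g 1 := by
      rw [MonoidAlgebra.smul_single, smul_eq_mul, mul_one]
    suffices h : ∃ t : K, rowSymmetrizer K lam * MonoidAlgebra.single g 1 *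
        colAntisymmetrizer K lam = t • youngSymmetrizer K lam by
      obtain ⟨t, ht⟩ := h
      exact ⟨r * t, by rw [hr, mul_smul_comm, smul_mul_assoc, ht, mul_smul]⟩
    rw [youngSymmetrizer, rowSymmetrizer_eq, colAntisymmetrizer_eq]
    -- Either `g = p q` with `p` preserving rows and `q` preserving columns, and the product is the
    -- Young symmetrizer up to sign, or two boxes of one column go to one row, and the product
    -- vanishes.
    by_cases hg : ∀ w w' : lam.cells, (g w).1.1 = (g w').1.1 → w.1.2 = w'.1.2 → w = w'
    · obtain ⟨q, hq, hq'⟩ := exists_col_perm lam g hg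
      have hp : ∀ c, ((g * q⁻¹) c).1.1 = c.1.1 := fun c => by
        rw [Equiv.Perm.mul_apply, ← hq', Equiv.Perm.inv_def, Equiv.apply_symm_apply]
      have hgq : (MonoidAlgebra.single g 1 : MonoidAlgebra K (Equiv.Perm lam.cells)) =
          MonoidAlgebra.single (g * q⁻¹) 1 * MonoidAlgebra.single q 1 := by
        rw [MonoidAlgebra.single_mul_single, inv_mul_cancel_right, mul_one]
      refine ⟨((Equiv.Perm.sign q : ℤ) : K), ?_⟩
      rw [hgq, ← mul_assoc, fiberSymmetrizer_mul_single _ hp, mul_assoc,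
        single_mul_fiberAntisymmetrizer _ hq, mul_smul_comm]
    · push Not at hg
      obtain ⟨w, w', hrow, hcol, hne⟩ := hg
      refine ⟨0, ?_⟩
      have hs : ∀ c, ((Equiv.swap (g w) (g w')) c).1.1 = c.1.1 := fun c => by
        rw [Equiv.swap_apply_def]
        split_ifs with h1 h2
        · rw [h1, hrow]
        · rw [h2, hrow]
        · rfl
      have hs' : ∀ c, ((Equiv.swap w w') c).1.2 = c.1.2 := fun c => by
        rw [Equiv.swap_apply_def]
        split_ifs with h1 h2
        · rw [h1, hcol]
        · rw [h2, hcol]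
        · rfl
      have hcomm : (MonoidAlgebra.single (Equiv.swap (g w) (g w')) 1 :
          MonoidAlgebra K (Equiv.Perm lam.cells)) * MonoidAlgebra.single g 1 =
          MonoidAlgebra.single g 1 * MonoidAlgebra.single (Equiv.swap w w') 1 := by
        rw [MonoidAlgebra.single_mul_single, MonoidAlgebra.single_mul_single,
          Equiv.mul_swap_eq_swap_mul]
      -- The row symmetrizer absorbs the swap of the two images; moved past `g` this becomes a swap
      -- within a column, which the antisymmetrizer turns into -1. The product is thus its own
      -- negative.
      have h := congrArg (fun y => y * MonoidAlgebra.single g 1 *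
        fiberAntisymmetrizer K fun c : lam.cells => c.1.2)
        (fiberSymmetrizer_mul_single (K := K) (fun c : lam.cells => c.1.1) hs)
      rw [mul_assoc (fiberSymmetrizer K _), hcomm, ← mul_assoc, mul_assoc _ _
        (fiberAntisymmetrizer K _), single_mul_fiberAntisymmetrizer _ hs',
        Equiv.Perm.sign_swap hne, mul_smul_comm] at h
      simp only [Units.val_neg, Units.val_one, Int.cast_neg, Int.cast_one, neg_smul,
        one_smul] at h
      rw [zero_smul]
      refine (smul_eq_zero_iff_right (two_ne_zero (α := K))).1 ?_
      rw [two_smul]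
      nth_rw 1 [← h]
      exact neg_add_cancel _

/-- The square of `a b` is `a (b a) b`, a multiple of `a b`. The factor is nonzero by the trace
argument, the coefficient at the identity being 1. -/
theorem exists_youngSymmetrizer_mul_self :
    ∃ h : K, h ≠ 0 ∧ youngSymmetrizer K lam * youngSymmetrizer K lam =
      h • youngSymmetrizer K lam := by
  obtain ⟨h, hh⟩ := exists_rowSymmetrizer_mul_mul (K := K) lam
    (colAntisymmetrizer K lam * rowSymmetrizer K lam)
  have hh' : youngSymmetrizer K lam * youngSymmetrizer K lam = h • youngSymmetrizer K lam := by
    rw [← hh]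
    simp only [youngSymmetrizer, mul_assoc]
  refine ⟨h, ne_zero_of_mul_self_eq_smul ?_ hh', hh'⟩
  have : (youngSymmetrizer K lam).coeff 1 = 1 :=
    coeff_one_fiberSymmetrizer_mul_fiberAntisymmetrizer (K := K) (ι := lam.cells)
      (fun c => c.1.1) (fun c => c.1.2) fun c d h1 h2 => Subtype.ext (Prod.ext h1 h2)
  rw [this]
  exact one_ne_zero

end Young

/-! ### Partial traces of permutations -/

section FirstReturn

variable {n : Type*} [Fintype n] [DecidableEq n]

-- Removal of one point. If `κ` fixes `none`, the value `a` there is free and contributes a factor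
-- `Fintype.card n`; otherwise `a` is forced to be `p u`, where `κ none = some u`. In both cases
-- `Equiv.removeNone κ` is the first return map, which skips `none`.
open Classical in
theorem exists_card_option_extension {δ : Type*} (κ : Equiv.Perm (Option δ)) :
    ∃ (m : ℕ) (π : Equiv.Perm δ), ∀ p p' : δ → n,
      (∑ a : n, if (fun x => Option.elim (κ x) a p) = (fun x => Option.elim x a p') then 1 else 0)
        = if p ∘ π = p' then m else 0 := by
  by_cases h : κ none = none
  · refine ⟨Fintype.card n, Equiv.removeNone κ, fun p p' => ?_⟩
    have hsome : ∀ x, κ (some x) = some (Equiv.removeNone κ x) := fun x => by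
      refine (Equiv.removeNone_some κ ?_).symm
      refine Option.ne_none_iff_exists'.1 fun h' => ?_
      exact Option.some_ne_none x (κ.injective (h'.trans h.symm))
    have : ∀ a : n, ((fun x => Option.elim (κ x) a p) = fun x => Option.elim x a p') ↔
        p ∘ Equiv.removeNone κ = p' := by
      intro a
      constructor
      · intro e
        funext x
        have := congrFun e (some x)
        simpa [hsome] using this
      · rintro rfl
        funext x
        cases x with
        | none => simp [h]
        | some x => simp [hsome]
    simp only [this]
    split_ifs <;> simp
  · obtain ⟨u, hu⟩ := Option.ne_none_iff_exists'.1 h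
    refine ⟨1, Equiv.removeNone κ, fun p p' => ?_⟩
    have : ∀ a : n, ((fun x => Option.elim (κ x) a p) = fun x => Option.elim x a p') ↔
        a = p u ∧ p ∘ Equiv.removeNone κ = p' := by
      intro a
      constructor
      · intro e
        have ha : a = p u := by simpa [hu] using (congrFun e none).symm
        refine ⟨ha, ?_⟩
        funext x
        have hx := congrFun e (some x)
        rcases hk : κ (some x) with _ | y
        · have h1 := Equiv.removeNone_none κ hk
          rw [hu, Option.some_inj] at h1
          rw [hk] at hx
          simpa [h1, ← ha] using hx
        · have h1 := Equiv.removeNone_some κ ⟨y, hk⟩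
          rw [hk, Option.some_inj] at h1
          rw [hk] at hx
          simpa [h1] using hx
      · rintro ⟨rfl, rfl⟩
        funext x
        cases x with
        | none => simp [hu]
        | some x =>
          rcases hk : κ (some x) with _ | y
          · have h1 := Equiv.removeNone_none κ hk
            rw [hu, Option.some_inj] at h1
            simp [h1]
          · have h1 := Equiv.removeNone_some κ ⟨y, hk⟩
            rw [hk, Option.some_inj] at h1
            simp [h1]
    simp only [this]
    by_cases hp : p ∘ Equiv.removeNone κ = p' <;> simp [hp]

open Classical in
/-- Counting the extensions of `p` to `ι ⊕ β` that a permutation carries to extensions of `p'` with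
the same values on `β` amounts to comparing `p` and `p'` along the first return map to `ι`. -/
theorem exists_card_sum_extension {ι : Type*} (β : Type*) [Fintype β]
    (κ : Equiv.Perm (ι ⊕ β)) :
    ∃ (m : ℕ) (π : Equiv.Perm ι), ∀ p p' : ι → n,
      (∑ q : β → n, if Sum.elim p q ∘ κ = Sum.elim p' q then 1 else 0)
        = if p ∘ π = p' then m else 0 := by
  revert κ
  -- The points of `β` are removed one at a time; the multiplicities multiply and the return maps
  -- compose to a return map to `ι`.
  refine Fintype.induction_empty_option (P := fun β _ => ∀ κ : Equiv.Perm (ι ⊕ β),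
    ∃ (m : ℕ) (π : Equiv.Perm ι), ∀ p p' : ι → n,
      (∑ q : β → n, if Sum.elim p q ∘ κ = Sum.elim p' q then 1 else 0)
        = if p ∘ π = p' then m else 0) ?_ ?_ ?_ β
  · intro α β _ e ih κ
    let _ : Fintype α := Fintype.ofEquiv β e.symm
    let s : ι ⊕ α ≃ ι ⊕ β := Equiv.sumCongr (Equiv.refl ι) e
    obtain ⟨m, π, h⟩ := ih (s.trans (κ.trans s.symm))
    refine ⟨m, π, fun p p' => ?_⟩
    rw [← h p p']
    refine Fintype.sum_equiv (Equiv.arrowCongr e.symm (Equiv.refl n)) _ _ fun q => ?_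
    have hs : ∀ p : ι → n,
        Sum.elim p (Equiv.arrowCongr e.symm (Equiv.refl n) q) = Sum.elim p q ∘ s := by
      intro p
      funext x
      cases x <;> simp [s]
    rw [hs, hs]
    refine if_congr ?_ rfl rfl
    rw [← s.surjective.injective_comp_right.eq_iff]
    have : (Sum.elim p q ∘ s) ∘ (s.trans (κ.trans s.symm)) = (Sum.elim p q ∘ κ) ∘ s := by
      funext x
      simp
    rw [this]
  · intro κ
    refine ⟨1, (Equiv.sumEmpty ι PEmpty).permCongr κ, fun p p' => ?_⟩
    rw [Fintype.sum_unique]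
    refine if_congr ?_ rfl rfl
    constructor
    · intro h
      funext x
      have := congrFun h (Sum.inl x)
      rcases hk : κ (Sum.inl x) with y | y
      · simpa [hk] using this
      · exact y.elim
    · rintro rfl
      funext x
      rcases x with x | x
      · rcases hk : κ (Sum.inl x) with y | y
        · simp [hk]
        · exact y.elim
      · exact x.elim
  · intro β _ ih κ
    let s : ι ⊕ Option β ≃ Option (ι ⊕ β) :=
      { toFun := Sum.elim (fun x => some (Sum.inl x)) fun o => o.map Sum.inr
        invFun := fun o => o.elim (Sum.inr none) (Sum.elim Sum.inl fun b => Sum.inr (some b))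
        left_inv := by rintro (x | _ | x) <;> rfl
        right_inv := by rintro (_ | x | x) <;> rfl }
    obtain ⟨m₁, π₁, h₁⟩ := exists_card_option_extension (n := n) (s.permCongr κ)
    obtain ⟨m₂, π₂, h₂⟩ := ih π₁
    refine ⟨m₂ * m₁, π₂, fun p p' => ?_⟩
    have hval : ∀ (p : ι → n) (a : n) (q : β → n) (x : ι ⊕ Option β),
        Sum.elim p (fun o : Option β => o.elim a q) x = (s x).elim a (Sum.elim p q) := by
      rintro p a q (x | _ | x) <;> rfl
    have key : ∀ (q : β → n) (a : n),
        (Sum.elim p (fun o : Option β => o.elim a q) ∘ κ =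
          Sum.elim p' (fun o : Option β => o.elim a q)) ↔
        ((fun x => Option.elim (s.permCongr κ x) a (Sum.elim p q)) =
          fun x => Option.elim x a (Sum.elim p' q)) := by
      intro q a
      constructor
      · intro h
        funext x
        have := congrFun h (s.symm x)
        simpa [hval] using this
      · intro h
        funext x
        have := congrFun h (s x)
        simpa [hval] using this
    let e : (Option β → n) ≃ (β → n) × n :=
      { toFun := fun f => (fun b => f (some b), f none)
        invFun := fun f o => o.elim f.2 f.1
        left_inv := fun f => by funext o; cases o <;> rfl
        right_inv := fun f => rfl }
    have hsum : (∑ q : Option β → n, if Sum.elim p q ∘ κ = Sum.elim p' q then 1 else 0) =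
        ∑ x : (β → n) × n, if Sum.elim p (e.symm x) ∘ κ = Sum.elim p' (e.symm x) then 1 else 0 :=
      Fintype.sum_equiv e _ _ fun q => by rw [e.symm_apply_apply]
    have : ∀ q : β → n, (∑ a : n, if Sum.elim p (e.symm (q, a)) ∘ κ =
        Sum.elim p' (e.symm (q, a)) then 1 else 0) =
        (if Sum.elim p q ∘ π₁ = Sum.elim p' q then 1 else 0) * m₁ := by
      intro q
      rw [ite_mul, one_mul, zero_mul, ← h₁]
      exact Finset.sum_congr rfl fun a _ => if_congr (key q a) rfl rfl
    rw [Fintype.sum_prod_type, Finset.sum_congr rfl fun q _ => this q, ← Finset.sum_mul, h₂,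
      ite_mul, zero_mul] at hsum
    convert hsum

end FirstReturn

/-! ### Maps between tensor powers given by kernels -/

section Kernel

variable {K : Type u} [Field K] {ι ι' n : Type*} [Fintype ι] [DecidableEq ι]
  [Fintype ι'] [DecidableEq ι'] [Fintype n] [DecidableEq n]
  {W W' : Type*} [AddCommGroup W'] [Module K W'] [AddCommGroup W] [Module K W]

/-- The basis of a tensor power given by a basis of the factor. -/
def tensorBasis (ι : Type*) [Fintype ι] (b : Module.Basis n K W) :
    Module.Basis (ι → n) K (⨂[K] _ : ι, W) :=
  Basis.piTensorProduct fun _ => b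

theorem tensorBasis_apply (b : Module.Basis n K W) (p : ι → n) :
    tensorBasis ι b p = PiTensorProduct.tprod K fun c => b (p c) :=
  Basis.piTensorProduct_apply _ _

theorem permRep_tensorBasis (b : Module.Basis n K W) (σ : Equiv.Perm ι) (p : ι → n) :
    permRep K ι W σ (tensorBasis ι b p) = tensorBasis ι b (p ∘ σ.symm) := by
  rw [tensorBasis_apply, tensorBasis_apply]
  exact PiTensorProduct.reindex_tprod σ _

theorem tensorBasis_coord_permRep (b : Module.Basis n K W) (σ : Equiv.Perm ι) (p : ι → n)
    (t : ⨂[K] _ : ι, W) :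
    (tensorBasis ι b).coord p (permRep K ι W σ t) = (tensorBasis ι b).coord (p ∘ σ) t := by
  classical
  suffices h : (tensorBasis ι b).coord p ∘ₗ permRep K ι W σ = (tensorBasis ι b).coord (p ∘ σ) from
    LinearMap.congr_fun h t
  refine (tensorBasis ι b).ext fun p' => ?_
  rw [LinearMap.comp_apply, permRep_tensorBasis, Module.Basis.coord_apply,
    Module.Basis.coord_apply, Module.Basis.repr_self, Module.Basis.repr_self,
    Finsupp.single_apply, Finsupp.single_apply]
  refine if_congr ?_ rfl rfl
  constructor
  · rintro rfl
    funext c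
    simp
  · rintro rfl
    funext c
    simp

/-- The map between tensor powers with the given matrix. -/
def kernelMap (b : Module.Basis n K W) (b' : Module.Basis n K W') (d : (ι → n) → (ι' → n) → ℤ) :
    (⨂[K] _ : ι, W) →ₗ[K] ⨂[K] _ : ι', W' :=
  (tensorBasis ι b).constr K fun p => ∑ q, (d p q : K) • tensorBasis ι' b' q

variable (b : Module.Basis n K W) (b' : Module.Basis n K W') (d : (ι → n) → (ι' → n) → ℤ)

theorem kernelMap_tensorBasis (p : ι → n) :
    kernelMap b b' d (tensorBasis ι b p) = ∑ q, (d p q : K) • tensorBasis ι' b' q :=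
  Module.Basis.constr_basis _ _ _ _

theorem coord_kernelMap_tensorBasis (p : ι → n) (q : ι' → n) :
    (tensorBasis ι' b').coord q (kernelMap b b' d (tensorBasis ι b p)) = d p q := by
  rw [kernelMap_tensorBasis, map_sum]
  simp [Finsupp.single_apply]

theorem coord_kernelMap (q : ι' → n) (t : ⨂[K] _ : ι, W) :
    (tensorBasis ι' b').coord q (kernelMap b b' d t) =
      ∑ p, (d p q : K) * (tensorBasis ι b).coord p t := by
  have h : (tensorBasis ι' b').coord q ∘ₗ kernelMap b b' d =
      ∑ p, (d p q : K) • (tensorBasis ι b).coord p := by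
    refine (tensorBasis ι b).ext fun p => ?_
    rw [LinearMap.comp_apply, coord_kernelMap_tensorBasis]
    simp [Finsupp.single_apply]
  have := LinearMap.congr_fun h t
  simpa using this

variable {d}

/-! ### Kernels alternating along columns -/

section Antisymmetry

variable {κ : Type*} [DecidableEq κ]

/-- The sign of `σ` in the antisymmetrizer cancels the sign by which the kernel changes, so every
term contributes the same map. -/
theorem kernelMap_comp_fiberAntisymmetrizer {col : ι → κ}
    (hcol : ∀ σ : Equiv.Perm ι, (∀ c, col (σ c) = col c) → ∀ p q,
      d (p ∘ σ) q = (Equiv.Perm.sign σ : ℤ) * d p q) :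
    kernelMap b b' d ∘ₗ (permRep K ι W).asAlgebraHom (fiberAntisymmetrizer K col) =
      (fiberPermCount col : K) • kernelMap b b' d := by
  refine (tensorBasis ι b).ext fun p => ?_
  rw [LinearMap.comp_apply, fiberAntisymmetrizer, map_sum, LinearMap.sum_apply, map_sum,
    LinearMap.smul_apply, fiberPermCount, Nat.cast_smul_eq_nsmul, ← Finset.sum_const]
  refine Finset.sum_congr rfl fun σ hσ => ?_
  have hσ' : ∀ c, col (σ.symm c) = col c := fun c => by
    have := (Finset.mem_filter.1 hσ).2 (σ.symm c)
    rw [← this, Equiv.apply_symm_apply]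
  rw [Representation.asAlgebraHom_single, LinearMap.smul_apply, map_smul, permRep_tensorBasis,
    kernelMap_tensorBasis, kernelMap_tensorBasis, Finset.smul_sum]
  refine Finset.sum_congr rfl fun q _ => ?_
  rw [hcol _ hσ', Equiv.Perm.sign_symm, smul_smul, ← Int.cast_mul, ← mul_assoc,
    Int.units_coe_mul_self, one_mul]

theorem fiberAntisymmetrizer_comp_kernelMap {col : ι' → κ}
    (hcol : ∀ σ : Equiv.Perm ι', (∀ c, col (σ c) = col c) → ∀ p q,
      d p (q ∘ σ) = (Equiv.Perm.sign σ : ℤ) * d p q) :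
    (permRep K ι' W').asAlgebraHom (fiberAntisymmetrizer K col) ∘ₗ kernelMap b b' d =
      (fiberPermCount col : K) • kernelMap b b' d := by
  refine (tensorBasis ι b).ext fun p => (tensorBasis ι' b').ext_elem fun q => ?_
  simp only [← Module.Basis.coord_apply]
  rw [LinearMap.comp_apply, fiberAntisymmetrizer, map_sum, LinearMap.sum_apply, map_sum,
    LinearMap.smul_apply, fiberPermCount, Nat.cast_smul_eq_nsmul, ← Finset.sum_const, map_sum]
  refine Finset.sum_congr rfl fun σ hσ => ?_
  rw [Representation.asAlgebraHom_single, LinearMap.smul_apply, map_smul,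
    tensorBasis_coord_permRep, coord_kernelMap_tensorBasis, coord_kernelMap_tensorBasis,
    hcol _ (Finset.mem_filter.1 hσ).2, smul_eq_mul, ← Int.cast_mul, ← mul_assoc,
    Int.units_coe_mul_self, one_mul]

end Antisymmetry

/-- If the composites of a kernel, a permutation and the transposed kernel are combinations of
permutations, then permutations may be replaced by arbitrary elements of the group algebra. -/
theorem exists_asAlgebraHom_eq_comp
    (htr : ∀ σ : Equiv.Perm ι', ∃ y : Equiv.Perm ι → ℤ, ∀ p p',
      ∑ q, d p q * d p' (q ∘ σ) = ∑ π, y π * if p ∘ π = p' then 1 else 0)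
    (a : MonoidAlgebra K (Equiv.Perm ι')) :
    ∃ Y : MonoidAlgebra K (Equiv.Perm ι), (permRep K ι W).asAlgebraHom Y =
      kernelMap b' b (fun q p => d p q) ∘ₗ (permRep K ι' W').asAlgebraHom a ∘ₗ
        kernelMap b b' d := by
  induction a using MonoidAlgebra.induction_linear with
  | zero => exact ⟨0, by simp⟩
  | add a a' ha ha' =>
    obtain ⟨Y, hY⟩ := ha
    obtain ⟨Y', hY'⟩ := ha'
    exact ⟨Y + Y', by rw [map_add, hY, hY', map_add, LinearMap.add_comp, LinearMap.comp_add]⟩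
  | single σ r =>
    -- Substituting `q ∘ σ` for `q` moves the permutation to the other factor and inverts it.
    obtain ⟨y, hy⟩ := htr σ.symm
    -- The inverse appears because `π⁻¹` sends the basis tensor of `p` to that of `p ∘ π`.
    refine ⟨r • ∑ π, MonoidAlgebra.single π⁻¹ (y π : K), ?_⟩
    rw [map_smul, Representation.asAlgebraHom_single, LinearMap.smul_comp, LinearMap.comp_smul]
    congr 1
    refine (tensorBasis ι b).ext fun p => (tensorBasis ι b).ext_elem fun p' => ?_
    simp only [← Module.Basis.coord_apply]
    rw [LinearMap.comp_apply, LinearMap.comp_apply, coord_kernelMap]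
    simp only [tensorBasis_coord_permRep, coord_kernelMap_tensorBasis]
    rw [map_sum, LinearMap.sum_apply, map_sum]
    have h1 : ∑ q, (d p' q : K) * (d p (q ∘ σ) : K) =
        ((∑ q, d p q * d p' (q ∘ σ.symm) : ℤ) : K) := by
      rw [Int.cast_sum]
      refine Fintype.sum_equiv (Equiv.arrowCongr σ.symm (Equiv.refl n)) _ _ fun q => ?_
      have e1 : (Equiv.arrowCongr σ.symm (Equiv.refl n)) q = q ∘ σ := rfl
      have e2 : (q ∘ σ) ∘ σ.symm = q := by funext c; simp
      rw [e1, e2, Int.cast_mul, mul_comm]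
    rw [h1, hy, Int.cast_sum]
    refine Finset.sum_congr rfl fun π _ => ?_
    rw [Representation.asAlgebraHom_single, LinearMap.smul_apply, map_smul, permRep_tensorBasis,
      Module.Basis.coord_apply, Module.Basis.repr_self, Finsupp.single_apply]
    have e : (π⁻¹ : Equiv.Perm ι).symm = π := rfl
    rw [e]
    simp

variable {κ κ' : Type*} [DecidableEq κ'] [DecidableEq κ]

/-- A diagonal coefficient of this composite is, up to a factor, a nonzero sum of squares. -/
theorem coord_symmetrized_kernelMap_ne_zero [CharZero K] {row : ι → κ} {row' : ι' → κ}
    {p₀ : ι → n} {q₀ : ι' → n}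
    (hp₀ : ∀ σ : Equiv.Perm ι, (∀ c, row (σ c) = row c) → p₀ ∘ σ = p₀)
    (hq₀ : ∀ σ : Equiv.Perm ι', (∀ c, row' (σ c) = row' c) → q₀ ∘ σ = q₀)
    (hne : d p₀ q₀ ≠ 0) :
    (permRep K ι W).asAlgebraHom (fiberSymmetrizer K row) ∘ₗ
      kernelMap b' b (fun q p => d p q) ∘ₗ
        (permRep K ι' W').asAlgebraHom (fiberSymmetrizer K row') ∘ₗ kernelMap b b' d ≠ 0 := by
  intro h0
  set P' := Finset.univ.filter (fun g : Equiv.Perm ι' => ∀ c, row' (g c) = row' c) with hP'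
  let e : (ι' → n) → ℤ := fun q => ∑ σ ∈ P', d p₀ (q ∘ σ)
  -- Since `p₀` is constant on rows, each term of the row symmetrizer leaves the coordinate at `p₀`
  -- unchanged.
  have hcoordA : ∀ t, (tensorBasis ι b).coord p₀
      ((permRep K ι W).asAlgebraHom (fiberSymmetrizer K row) t) =
        (fiberPermCount row : K) * (tensorBasis ι b).coord p₀ t := by
    intro t
    rw [fiberSymmetrizer, map_sum, LinearMap.sum_apply, map_sum, fiberPermCount, ← nsmul_eq_mul,
      ← Finset.sum_const]
    refine Finset.sum_congr rfl fun σ hσ => ?_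
    rw [Representation.asAlgebraHom_single, one_smul, tensorBasis_coord_permRep,
      hp₀ σ (Finset.mem_filter.1 hσ).2]
  have hcoordA' : ∀ q, (tensorBasis ι' b').coord q
      ((permRep K ι' W').asAlgebraHom (fiberSymmetrizer K row')
        (kernelMap b b' d (tensorBasis ι b p₀))) = (e q : K) := by
    intro q
    rw [fiberSymmetrizer, map_sum, LinearMap.sum_apply, map_sum, Int.cast_sum]
    refine Finset.sum_congr rfl fun σ hσ => ?_
    rw [Representation.asAlgebraHom_single, one_smul, tensorBasis_coord_permRep,
      coord_kernelMap_tensorBasis]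
  have h1 := congrArg ((tensorBasis ι b).coord p₀)
    (LinearMap.congr_fun h0 (tensorBasis ι b p₀))
  rw [LinearMap.comp_apply, hcoordA, LinearMap.zero_apply, map_zero, LinearMap.comp_apply,
    coord_kernelMap] at h1
  simp only [LinearMap.comp_apply, hcoordA'] at h1
  have h2 := (mul_eq_zero.1 h1).resolve_left
    (Nat.cast_ne_zero.2 (fiberPermCount_pos row).ne')
  -- The vanishing is carried back to `ℤ`, where positivity of squares is available.
  have h3 : ∑ q, d p₀ q * e q = 0 := by exact_mod_cast h2
  have hinv : ∀ σ ∈ P', ∀ q, e (q ∘ σ) = e q := by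
    intro σ hσ q
    simp only [hP', Finset.mem_filter, Finset.mem_univ, true_and] at hσ
    refine Finset.sum_nbij' (fun g => σ * g) (fun g => σ⁻¹ * g) ?_ ?_ ?_ ?_ ?_
    · intro g hg
      simp only [hP', Finset.mem_filter, Finset.mem_univ, true_and] at hg ⊢
      intro c
      rw [Equiv.Perm.mul_apply, hσ, hg]
    · intro g hg
      simp only [hP', Finset.mem_filter, Finset.mem_univ, true_and] at hg ⊢
      intro c
      rw [Equiv.Perm.mul_apply, ← hσ, Equiv.Perm.inv_def, Equiv.apply_symm_apply, hg]
    · simp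
    · simp
    · intro g _
      rfl
  -- As `e` is invariant under `P'`, each term of the symmetrization pairs with `e` to the same
  -- value, which is zero by `h3`.
  have h4 : ∑ q, e q * e q = 0 := by
    have : ∀ σ ∈ P', ∑ q, d p₀ (q ∘ σ) * e q = 0 := by
      intro σ hσ
      rw [← h3]
      refine Fintype.sum_equiv (Equiv.arrowCongr σ.symm (Equiv.refl n)) _ _ fun q => ?_
      have e1 : (Equiv.arrowCongr σ.symm (Equiv.refl n)) q = q ∘ σ := rfl
      rw [e1, hinv σ hσ]
    calc ∑ q, e q * e q = ∑ q, ∑ σ ∈ P', d p₀ (q ∘ σ) * e q :=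
          Finset.sum_congr rfl fun q _ => Finset.sum_mul _ _ _
      _ = ∑ σ ∈ P', ∑ q, d p₀ (q ∘ σ) * e q := Finset.sum_comm
      _ = 0 := Finset.sum_eq_zero this
  have h5 := (Finset.sum_eq_zero_iff_of_nonneg fun q _ => mul_self_nonneg (e q)).1 h4 q₀
    (Finset.mem_univ _)
  -- Since `q₀` is constant on rows, all terms of `e q₀` agree, so this square is not zero.
  have h6 : e q₀ = P'.card * d p₀ q₀ := by
    rw [← nsmul_eq_mul, ← Finset.sum_const]
    exact Finset.sum_congr rfl fun σ hσ => by rw [hq₀ σ (Finset.mem_filter.1 hσ).2]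
  rw [h6] at h5
  exact mul_ne_zero (Nat.cast_ne_zero.2 (fiberPermCount_pos row').ne') hne
    (mul_self_eq_zero.1 h5)

/-- The three rightmost factors act as some `Y` in the group algebra, and the kernel absorbs the
column antisymmetrizer `b` up to a nonzero factor. So `a Y` acts as a multiple of `a Y b`, hence of
`a b`. The comparison is made between operators because the group algebra need not act faithfully.
-/
theorem exists_comp_eq_smul_youngSymmetrizer [CharZero K] {row : ι → κ} {col : ι → κ'}
    {row' : ι' → κ} {p₀ : ι → n} {q₀ : ι' → n}
    (hcol : ∀ σ : Equiv.Perm ι, (∀ c, col (σ c) = col c) → ∀ p q,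
      d (p ∘ σ) q = (Equiv.Perm.sign σ : ℤ) * d p q)
    (htr : ∀ σ : Equiv.Perm ι', ∃ y : Equiv.Perm ι → ℤ, ∀ p p',
      ∑ q, d p q * d p' (q ∘ σ) = ∑ π, y π * if p ∘ π = p' then 1 else 0)
    (hp₀ : ∀ σ : Equiv.Perm ι, (∀ c, row (σ c) = row c) → p₀ ∘ σ = p₀)
    (hq₀ : ∀ σ : Equiv.Perm ι', (∀ c, row' (σ c) = row' c) → q₀ ∘ σ = q₀)
    (hne : d p₀ q₀ ≠ 0)
    (hyoung : ∀ x, ∃ t : K, fiberSymmetrizer K row * x * fiberAntisymmetrizer K col =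
      t • (fiberSymmetrizer K row * fiberAntisymmetrizer K col)) :
    ∃ u : K, u ≠ 0 ∧ (permRep K ι W).asAlgebraHom (fiberSymmetrizer K row) ∘ₗ
      kernelMap b' b (fun q p => d p q) ∘ₗ
        (permRep K ι' W').asAlgebraHom (fiberSymmetrizer K row') ∘ₗ kernelMap b b' d =
      u • (permRep K ι W).asAlgebraHom
        (fiberSymmetrizer K row * fiberAntisymmetrizer K col) := by
  obtain ⟨Y, hY⟩ := exists_asAlgebraHom_eq_comp (K := K) b b' htr (fiberSymmetrizer K row')
  obtain ⟨t, ht⟩ := hyoung Y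
  have hβ : (fiberPermCount col : K) ≠ 0 := Nat.cast_ne_zero.2 (fiberPermCount_pos col).ne'
  have hB := kernelMap_comp_fiberAntisymmetrizer (K := K) b b' hcol
  have h1 : (permRep K ι W).asAlgebraHom Y ∘ₗ
      (permRep K ι W).asAlgebraHom (fiberAntisymmetrizer K col) =
        (fiberPermCount col : K) • (permRep K ι W).asAlgebraHom Y := by
    rw [hY, LinearMap.comp_assoc, LinearMap.comp_assoc, hB, LinearMap.comp_smul,
      LinearMap.comp_smul]
  have h2 : (permRep K ι W).asAlgebraHom (fiberSymmetrizer K row) ∘ₗ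
      (permRep K ι W).asAlgebraHom Y = ((fiberPermCount col : K)⁻¹ * t) •
        (permRep K ι W).asAlgebraHom
          (fiberSymmetrizer K row * fiberAntisymmetrizer K col) := by
    rw [mul_smul, ← map_smul _ t, ← ht, eq_inv_smul_iff₀ hβ, ← LinearMap.comp_smul, ← h1,
      map_mul, map_mul]
    rfl
  rw [← hY]
  refine ⟨_, fun hu => ?_, h2⟩
  rw [hu, zero_smul, hY] at h2
  exact coord_symmetrized_kernelMap_ne_zero (K := K) b b' hp₀ hq₀ hne h2

/-- The equivalence of images of Young symmetrizers induced by a kernel. -/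
theorem exists_range_equiv [CharZero K] {row : ι → κ} {col : ι → κ'}
    {row' : ι' → κ} {col' : ι' → κ'} {p₀ : ι → n} {q₀ : ι' → n}
    (hcol : ∀ σ : Equiv.Perm ι, (∀ c, col (σ c) = col c) → ∀ p q,
      d (p ∘ σ) q = (Equiv.Perm.sign σ : ℤ) * d p q)
    (hcol' : ∀ σ : Equiv.Perm ι', (∀ c, col' (σ c) = col' c) → ∀ p q,
      d p (q ∘ σ) = (Equiv.Perm.sign σ : ℤ) * d p q)
    (htr : ∀ σ : Equiv.Perm ι', ∃ y : Equiv.Perm ι → ℤ, ∀ p p',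
      ∑ q, d p q * d p' (q ∘ σ) = ∑ π, y π * if p ∘ π = p' then 1 else 0)
    (htr' : ∀ σ : Equiv.Perm ι, ∃ y : Equiv.Perm ι' → ℤ, ∀ q q',
      ∑ p, d p q * d (p ∘ σ) q' = ∑ π, y π * if q ∘ π = q' then 1 else 0)
    (hp₀ : ∀ σ : Equiv.Perm ι, (∀ c, row (σ c) = row c) → p₀ ∘ σ = p₀)
    (hq₀ : ∀ σ : Equiv.Perm ι', (∀ c, row' (σ c) = row' c) → q₀ ∘ σ = q₀)
    (hne : d p₀ q₀ ≠ 0)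
    (hyoung : ∀ x, ∃ t : K, fiberSymmetrizer K row * x * fiberAntisymmetrizer K col =
      t • (fiberSymmetrizer K row * fiberAntisymmetrizer K col))
    (hyoung' : ∀ x, ∃ t : K, fiberSymmetrizer K row' * x * fiberAntisymmetrizer K col' =
      t • (fiberSymmetrizer K row' * fiberAntisymmetrizer K col'))
    {y : MonoidAlgebra K (Equiv.Perm ι)} {y' : MonoidAlgebra K (Equiv.Perm ι')}
    (hy : y = fiberSymmetrizer K row * fiberAntisymmetrizer K col)
    (hy' : y' = fiberSymmetrizer K row' * fiberAntisymmetrizer K col')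
    (hsq : ∃ h : K, h ≠ 0 ∧ y * y = h • y) (hsq' : ∃ h : K, h ≠ 0 ∧ y' * y' = h • y') :
    ∃ F : LinearMap.range ((permRep K ι W).asAlgebraHom y) ≃ₗ[K]
        LinearMap.range ((permRep K ι' W').asAlgebraHom y'),
      ∀ x, (F x : ⨂[K] _ : ι', W') =
        (permRep K ι' W').asAlgebraHom (fiberSymmetrizer K row') (kernelMap b b' d x) := by
  obtain ⟨u, hu, hGF⟩ := exists_comp_eq_smul_youngSymmetrizer (K := K) b b' hcol htr hp₀ hq₀ hne
    hyoung
  obtain ⟨u', hu', hFG⟩ := exists_comp_eq_smul_youngSymmetrizer (K := K) (W := W') (W' := W) b' b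
    (d := fun q p => d p q) (fun σ hσ p q => hcol' σ hσ q p) htr' hq₀ hp₀ hne hyoung'
  rw [← hy] at hGF
  rw [← hy'] at hFG
  obtain ⟨h, hh, hsq⟩ := hsq
  obtain ⟨h', hh', hsq'⟩ := hsq'
  have hβ : (fiberPermCount col : K) ≠ 0 := Nat.cast_ne_zero.2 (fiberPermCount_pos col).ne'
  have hβ' : (fiberPermCount col' : K) ≠ 0 := Nat.cast_ne_zero.2 (fiberPermCount_pos col').ne'
  let F₀ := (permRep K ι' W').asAlgebraHom (fiberSymmetrizer K row') ∘ₗ kernelMap b b' d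
  let G₀ := (permRep K ι W).asAlgebraHom (fiberSymmetrizer K row) ∘ₗ
    kernelMap b' b (fun q p => d p q)
  -- The kernel map is a multiple of its own column antisymmetrization, so applying the row
  -- symmetrizer gives an element of the image of `y'`.
  have hF₀ : ∀ t, F₀ t ∈ LinearMap.range ((permRep K ι' W').asAlgebraHom y') := by
    intro t
    refine ⟨(fiberPermCount col' : K)⁻¹ • kernelMap b b' d t, ?_⟩
    have := LinearMap.congr_fun
      (fiberAntisymmetrizer_comp_kernelMap (K := K) b b' hcol') t
    rw [LinearMap.comp_apply, LinearMap.smul_apply] at this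
    rw [hy', map_mul, Module.End.mul_apply, map_smul, this, inv_smul_smul₀ hβ']
    rfl
  have hG₀ : ∀ t, G₀ t ∈ LinearMap.range ((permRep K ι W).asAlgebraHom y) := by
    intro t
    refine ⟨(fiberPermCount col : K)⁻¹ • kernelMap b' b (fun q p => d p q) t, ?_⟩
    have := LinearMap.congr_fun
      (fiberAntisymmetrizer_comp_kernelMap (K := K) (d := fun q p => d p q) b' b
        (fun σ hσ p q => hcol σ hσ q p)) t
    rw [LinearMap.comp_apply, LinearMap.smul_apply] at this
    rw [hy, map_mul, Module.End.mul_apply, map_smul, this, inv_smul_smul₀ hβ]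
    rfl
  -- On the image of `y`, multiplication by `y` is the scalar `h`.
  have hGF' : ∀ x : LinearMap.range ((permRep K ι W).asAlgebraHom y),
      G₀ (F₀ x) = (u * h) • (x : ⨂[K] _ : ι, W) := by
    rintro ⟨_, t, rfl⟩
    have := LinearMap.congr_fun hGF ((permRep K ι W).asAlgebraHom y t)
    refine this.trans ?_
    rw [LinearMap.smul_apply, ← Module.End.mul_apply, ← map_mul, hsq, map_smul,
      LinearMap.smul_apply, mul_smul]
  have hFG' : ∀ x : LinearMap.range ((permRep K ι' W').asAlgebraHom y'),
      F₀ (G₀ x) = (u' * h') • (x : ⨂[K] _ : ι', W') := by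
    rintro ⟨_, t, rfl⟩
    have := LinearMap.congr_fun hFG ((permRep K ι' W').asAlgebraHom y' t)
    refine this.trans ?_
    rw [LinearMap.smul_apply, ← Module.End.mul_apply, ← map_mul, hsq', map_smul,
      LinearMap.smul_apply, mul_smul]
  refine ⟨LinearEquiv.ofBijective
    (LinearMap.codRestrict _ (F₀ ∘ₗ Submodule.subtype _) fun x => hF₀ x) ⟨?_, ?_⟩, fun x => rfl⟩
  · refine (injective_iff_map_eq_zero _).2 fun x hx => ?_
    have h1 : F₀ x = 0 := congrArg Subtype.val hx
    have h2 := hGF' x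
    rw [h1, map_zero] at h2
    exact Subtype.ext ((smul_eq_zero.1 h2.symm).resolve_left (mul_ne_zero hu hh))
  · intro x
    refine ⟨⟨(u' * h')⁻¹ • G₀ x, Submodule.smul_mem _ _ (hG₀ x)⟩, Subtype.ext ?_⟩
    change F₀ ((u' * h')⁻¹ • G₀ x) = _
    rw [map_smul, hFG', inv_smul_smul₀ (mul_ne_zero hu' hh')]

end Kernel

/-! ### The determinant kernel -/

section ColumnDet

variable {n J : Type*} [Fintype n] [DecidableEq n] [Fintype J] [DecidableEq J]

/-- The matrix whose columns are the standard basis vectors indexed by the values of `f`. -/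
def selectionMatrix (f : n → n) : Matrix n n ℤ := Matrix.of fun i i' => if f i' = i then 1 else 0

/-- The product over all columns `j` of the sign of `f (·, j)`, understood to be zero for maps that
are not bijective. -/
def columnDet (f : n × J → n) : ℤ := ∏ j, (selectionMatrix fun i => f (i, j)).det

theorem columnDet_fst : columnDet (Prod.fst : n × J → n) = 1 := by
  refine Finset.prod_eq_one fun j _ => ?_
  have : (selectionMatrix fun i : n => (i, j).1) = 1 := by
    ext a b
    simp [selectionMatrix, Matrix.one_apply, eq_comm]
  rw [this, Matrix.det_one]

/-- A permutation preserving columns is a family of permutations, one for each column, and its sign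
is the product of theirs; each determinant changes by the sign of its own member. -/
theorem columnDet_comp (f : n × J → n) (τ : Equiv.Perm (n × J)) (hτ : ∀ c, (τ c).2 = c.2) :
    columnDet (f ∘ τ) = (Equiv.Perm.sign τ : ℤ) * columnDet f := by
  have hτ' : ∀ c, (τ.symm c).2 = c.2 := fun c => by rw [← hτ, Equiv.apply_symm_apply]
  let s : J → Equiv.Perm n := fun j =>
    { toFun := fun i => (τ (i, j)).1
      invFun := fun i => (τ.symm (i, j)).1
      left_inv := fun i => by
        have : ((τ (i, j)).1, j) = τ (i, j) := Prod.ext rfl (hτ (i, j)).symm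
        simp [this]
      right_inv := fun i => by
        have : ((τ.symm (i, j)).1, j) = τ.symm (i, j) := Prod.ext rfl (hτ' (i, j)).symm
        simp [this] }
  have hs : τ = Equiv.prodCongrLeft s := by
    ext1 c
    exact Prod.ext rfl (hτ c)
  rw [hs, Equiv.Perm.sign_prodCongrLeft, Units.coe_prod, columnDet, columnDet,
    ← Finset.prod_mul_distrib]
  refine Finset.prod_congr rfl fun j _ => ?_
  exact Matrix.det_permute' (s j) (selectionMatrix fun i => f (i, j))

/-- In each column det M · det M' = det (Mᵀ M'), and the entries of Mᵀ M' test equality of values of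
`f` and `f'`. The Leibniz formula then gives the product of two Levi-Civita symbols as a signed sum
over permutations. -/
theorem columnDet_mul_columnDet (f f' : n × J → n) :
    columnDet f * columnDet f' = ∑ s : J → Equiv.Perm n,
      (∏ j, (Equiv.Perm.sign (s j) : ℤ)) *
        if f ∘ Equiv.prodCongrLeft s = f' then 1 else 0 := by
  have h : ∀ j, (selectionMatrix fun i => f (i, j)).det * (selectionMatrix fun i => f' (i, j)).det =
      ∑ t : Equiv.Perm n, (Equiv.Perm.sign t : ℤ) *
        if ∀ i, f (t i, j) = f' (i, j) then 1 else 0 := by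
    intro j
    rw [← Matrix.det_transpose, ← Matrix.det_mul, Matrix.det_apply']
    refine Finset.sum_congr rfl fun t _ => ?_
    have : ∀ i, ((selectionMatrix fun i => f (i, j)).transpose *
        selectionMatrix fun i => f' (i, j)) (t i) i =
          if f (t i, j) = f' (i, j) then 1 else 0 := by
      intro i
      simp [selectionMatrix, Matrix.mul_apply, eq_comm]
    simp only [this, Finset.prod_ite_zero, Finset.prod_const_one, Finset.mem_univ, true_implies]
    rfl
  rw [columnDet, columnDet, ← Finset.prod_mul_distrib, Finset.prod_congr rfl fun j _ => h j,
    Fintype.prod_sum]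
  refine Finset.sum_congr rfl fun s _ => ?_
  rw [Finset.prod_mul_distrib]
  congr 1
  simp only [Finset.prod_ite_zero, Finset.prod_const_one, Finset.mem_univ, true_implies]
  refine if_congr ?_ rfl rfl
  constructor
  · intro h
    funext c
    exact h c.2 c.1
  · rintro rfl j i
    rfl

/-- Both sides are the determinant of `g` times the selection matrix: the left one is its
multilinear expansion along the columns. This is the action of `g` on the top exterior power. -/
theorem sum_prod_mul_det_selectionMatrix {K : Type*} [Field K] (g : Matrix n n K) (f : n → n) :
    ∑ f' : n → n, (∏ i, g (f' i) (f i)) * ((selectionMatrix f').det : K) =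
      g.det * ((selectionMatrix f).det : K) := by
  have hcast : ∀ f : n → n, ((selectionMatrix f).det : K) =
      Matrix.detRowAlternating fun i => (Pi.single (f i) 1 : n → K) := by
    intro f
    rw [← Matrix.det_transpose]
    change Int.castRingHom K _ = _
    rw [RingHom.map_det]
    congr 1
    ext a b
    simp [selectionMatrix, Pi.single_apply, eq_comm, apply_ite]
  have hprod : g.det * ((selectionMatrix f).det : K) =
      Matrix.detRowAlternating fun i => ∑ k, g k (f i) • (Pi.single k 1 : n → K) := by
    change g.det * Int.castRingHom K _ = _
    rw [RingHom.map_det, ← Matrix.det_mul, ← Matrix.det_transpose]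
    congr 1
    ext a b
    simp [selectionMatrix, Matrix.mul_apply, Finset.sum_apply, Pi.single_apply]
  rw [hprod]
  change _ = Matrix.detRowAlternating.toMultilinearMap _
  rw [MultilinearMap.map_sum]
  refine Finset.sum_congr rfl fun f' _ => ?_
  rw [MultilinearMap.map_smul_univ, hcast, smul_eq_mul]
  rfl

theorem sum_prod_mul_columnDet {K : Type*} [Field K] (g : Matrix n n K) (f : n × J → n) :
    ∑ f' : n × J → n, (∏ c, g (f' c) (f c)) * (columnDet f' : K) =
      g.det ^ Fintype.card J * (columnDet f : K) := by
  let e : (n × J → n) ≃ (J → n → n) :=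
    { toFun := fun f j i => f (i, j)
      invFun := fun f c => f c.2 c.1
      left_inv := fun _ => rfl
      right_inv := fun _ => rfl }
  rw [columnDet, Int.cast_prod, ← Finset.card_univ, ← Finset.prod_const,
    ← Finset.prod_mul_distrib]
  simp only [← sum_prod_mul_det_selectionMatrix g]
  rw [Fintype.prod_sum]
  refine Fintype.sum_equiv e _ _ fun f' => ?_
  rw [Finset.prod_mul_distrib, columnDet, Int.cast_prod, Fintype.prod_prod_type_right]
  rfl

variable {ι ι' : Type*} [Fintype ι'] [DecidableEq ι'] [Fintype ι] [DecidableEq ι]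

/-- The determinant kernel of a rectangle divided into two parts. -/
def detKernel (pos : ι ⊕ ι' ≃ n × J) (p : ι → n) (q : ι' → n) : ℤ :=
  columnDet (Sum.elim p q ∘ pos.symm)

/-- The two parts play symmetric roles; facts about the second follow from those about the first. -/
theorem detKernel_sumComm (pos : ι ⊕ ι' ≃ n × J) (p : ι → n) (q : ι' → n) :
    detKernel ((Equiv.sumComm ι' ι).trans pos) q p = detKernel pos p q := by
  unfold detKernel
  congr 1
  funext c
  rcases h : pos.symm c with x | x <;> simp [h]

/-- Extended by the identity on `ι'`, `σ` becomes a column-preserving permutation of the whole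
rectangle with the same sign. -/
theorem detKernel_comp_left (pos : ι ⊕ ι' ≃ n × J) (σ : Equiv.Perm ι)
    (hσ : ∀ c, (pos (Sum.inl (σ c))).2 = (pos (Sum.inl c)).2) (p : ι → n) (q : ι' → n) :
    detKernel pos (p ∘ σ) q = (Equiv.Perm.sign σ : ℤ) * detKernel pos p q := by
  have hsign : Equiv.Perm.sign σ =
      Equiv.Perm.sign (pos.permCongr (Equiv.Perm.sumCongr σ (1 : Equiv.Perm ι'))) := by
    rw [Equiv.Perm.sign_permCongr, Equiv.Perm.sign_sumCongr, Equiv.Perm.sign_one, mul_one]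
  rw [detKernel, detKernel, hsign, ← columnDet_comp]
  · congr 1
    funext c
    rcases h : pos.symm c with x | x <;> simp [h]
  · intro c
    obtain ⟨x, rfl⟩ := pos.surjective c
    rcases x with x | x <;> simp [hσ]

/-- The product of kernels is a signed sum over column permutations `s`. For fixed `s`, summing over
`q` is a partial trace over `ι'`, and only the first return map to `ι` survives, with a
multiplicity. -/
theorem exists_sum_detKernel_mul (pos : ι ⊕ ι' ≃ n × J) (σ : Equiv.Perm ι') :
    ∃ y : Equiv.Perm ι → ℤ, ∀ p p' : ι → n,
      ∑ q, detKernel pos p q * detKernel pos p' (q ∘ σ) =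
        ∑ π, y π * if p ∘ π = p' then 1 else 0 := by
  classical
  -- The column permutation read on `ι ⊕ ι'`, preceded by `σ⁻¹` on `ι'` so that `q ∘ σ` is replaced
  -- by `q`.
  let κ : (J → Equiv.Perm n) → Equiv.Perm (ι ⊕ ι') := fun s =>
    (Equiv.sumCongr (Equiv.refl ι) σ.symm).trans (pos.trans ((Equiv.prodCongrLeft s).trans pos.symm))
  choose m π hπ using fun s => exists_card_sum_extension (n := n) ι' (κ s)
  refine ⟨fun ρ => ∑ s, (∏ j, (Equiv.Perm.sign (s j) : ℤ)) * if π s = ρ then (m s : ℤ) else 0,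
    fun p p' => ?_⟩
  have hiff : ∀ (s : J → Equiv.Perm n) (q : ι' → n),
      (Sum.elim p q ∘ pos.symm) ∘ Equiv.prodCongrLeft s = Sum.elim p' (q ∘ σ) ∘ pos.symm ↔
        Sum.elim p q ∘ κ s = Sum.elim p' q := by
    intro s q
    constructor
    · intro h
      funext x
      have := congrFun h (pos (Equiv.sumCongr (Equiv.refl ι) σ.symm x))
      refine this.trans ?_
      rcases x with x | x <;> simp
    · intro h
      funext c
      obtain ⟨x, rfl⟩ := pos.surjective c
      rcases x with x | x
      · simpa [κ] using congrFun h (Sum.inl x)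
      · simpa [κ] using congrFun h (Sum.inr (σ x))
  have hsum : ∀ s : J → Equiv.Perm n,
      (∑ q : ι' → n, if Sum.elim p q ∘ κ s = Sum.elim p' q then (1 : ℤ) else 0) =
        if p ∘ π s = p' then (m s : ℤ) else 0 := by
    intro s
    have := congrArg (Nat.cast : ℕ → ℤ) (hπ s p p')
    push_cast at this
    convert this
  simp only [detKernel, columnDet_mul_columnDet, hiff]
  rw [Finset.sum_comm]
  simp only [← Finset.mul_sum, hsum, Finset.sum_mul]
  rw [Finset.sum_comm]
  refine Finset.sum_congr rfl fun s _ => ?_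
  simp only [mul_assoc, ← Finset.mul_sum]
  congr 1
  rw [Finset.sum_eq_single (π s)]
  · simp
  · intro ρ _ hρ
    rw [if_neg hρ.symm, zero_mul]
  · simp

/-- A pair of fillings of the two parts is a filling of the rectangle, so this is the transformation
rule of `columnDet`. -/
theorem sum_prod_mul_detKernel {K : Type*} [Field K] (pos : ι ⊕ ι' ≃ n × J) (g : Matrix n n K)
    (p : ι → n) (q : ι' → n) :
    ∑ q' : ι' → n, (∏ c, g (q' c) (q c)) *
        ∑ p' : ι → n, (detKernel pos p' q' : K) * ∏ c, g (p' c) (p c) =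
      g.det ^ Fintype.card J * (detKernel pos p q : K) := by
  rw [detKernel, ← sum_prod_mul_columnDet]
  simp only [Finset.mul_sum]
  rw [Finset.sum_comm, ← Fintype.sum_prod_type']
  refine Fintype.sum_equiv ((Equiv.sumArrowEquivProdArrow ι ι' n).symm.trans
    (Equiv.arrowCongr pos (Equiv.refl n))) _ _ fun f => ?_
  have hf : ((Equiv.sumArrowEquivProdArrow ι ι' n).symm.trans
    (Equiv.arrowCongr pos (Equiv.refl n))) f = Sum.elim f.1 f.2 ∘ pos.symm := rfl
  rw [hf, ← pos.prod_comp, Fintype.prod_sum_type]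
  simp only [Function.comp_apply, Equiv.symm_apply_apply, Sum.elim_inl, Sum.elim_inr, detKernel]
  ring

end ColumnDet

/-! ### Equivariance -/

section Equivariance

variable {K : Type u} [Field K] {ι ι' n J : Type*} [Fintype ι] [DecidableEq ι]
  [Fintype ι'] [DecidableEq ι'] [Fintype n] [DecidableEq n] [Fintype J] [DecidableEq J]
  {W : Type*} [AddCommGroup W] [Module K W]

theorem coord_map_tensorBasis (b : Module.Basis n K W) (g : W →ₗ[K] W) (p' : ι → n)
    (t : ⨂[K] _ : ι, W) :
    (tensorBasis ι b).coord p' (PiTensorProduct.map (fun _ => g) t) =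
      ∑ p, (∏ c, LinearMap.toMatrix b b g (p' c) (p c)) * (tensorBasis ι b).coord p t := by
  have h : (tensorBasis ι b).coord p' ∘ₗ PiTensorProduct.map (fun _ => g) =
      ∑ p, (∏ c, LinearMap.toMatrix b b g (p' c) (p c)) • (tensorBasis ι b).coord p := by
    refine (tensorBasis ι b).ext fun p => ?_
    have h1 : (tensorBasis ι b).coord p' (PiTensorProduct.map (fun _ => g) (tensorBasis ι b p)) =
        ∏ c, LinearMap.toMatrix b b g (p' c) (p c) := by
      rw [tensorBasis_apply, PiTensorProduct.map_tprod, Module.Basis.coord_apply, tensorBasis,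
        Basis.piTensorProduct_repr_tprod_apply]
      simp [LinearMap.toMatrix_apply]
    rw [LinearMap.comp_apply, h1]
    simp [Finsupp.single_apply]
  simpa using LinearMap.congr_fun h t

/-- The kernel is a bilinear pairing that scales by a power of the determinant when `g` acts on both
arguments. With the transpose on the left, no inverse of `g` is needed. -/
theorem map_dualMap_kernelMap (pos : ι ⊕ ι' ≃ n × J) (b : Module.Basis n K W) (g : W →ₗ[K] W)
    (t : ⨂[K] _ : ι, W) :
    PiTensorProduct.map (fun _ => g.dualMap)
        (kernelMap b b.dualBasis (detKernel pos) (PiTensorProduct.map (fun _ => g) t)) =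
      LinearMap.det g ^ Fintype.card J • kernelMap b b.dualBasis (detKernel pos) t := by
  suffices h : PiTensorProduct.map (fun _ => g.dualMap) ∘ₗ
      kernelMap b b.dualBasis (detKernel pos) ∘ₗ PiTensorProduct.map (fun _ => g) =
      LinearMap.det g ^ Fintype.card J • kernelMap b b.dualBasis (detKernel pos) from
    LinearMap.congr_fun h t
  refine (tensorBasis ι b).ext fun p => (tensorBasis ι' b.dualBasis).ext_elem fun q => ?_
  simp only [← Module.Basis.coord_apply]
  have hdual : LinearMap.toMatrix b.dualBasis b.dualBasis g.dualMap =
      (LinearMap.toMatrix b b g).transpose := LinearMap.toMatrix_transpose g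
  rw [LinearMap.comp_apply, LinearMap.comp_apply, coord_map_tensorBasis, hdual,
    LinearMap.smul_apply, map_smul, coord_kernelMap_tensorBasis, ← LinearMap.det_toMatrix b,
    smul_eq_mul, ← sum_prod_mul_detKernel]
  refine Finset.sum_congr rfl fun q' _ => ?_
  rw [coord_kernelMap]
  congr 1
  refine Finset.sum_congr rfl fun p' _ => ?_
  rw [coord_map_tensorBasis]
  congr 1
  simp [Finsupp.single_apply]

end Equivariance

/-! ### Duality of Schur functors -/

section Duality

theorem lt_of_mem_of_colLen_le {lam : YoungDiagram} {r : ℕ} (hlam : lam.colLen 0 ≤ r)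
    {c : ℕ × ℕ} (hc : c ∈ lam) : c.1 < r ∧ c.2 < lam.rowLen 0 := by
  obtain ⟨i, j⟩ := c
  exact ⟨(YoungDiagram.mem_iff_lt_colLen.1 hc).trans_le
      ((lam.colLen_anti 0 j (Nat.zero_le _)).trans hlam),
    (YoungDiagram.mem_iff_lt_rowLen.1 hc).trans_le (lam.rowLen_anti 0 i (Nat.zero_le _))⟩

theorem mem_rectComplement {lam : YoungDiagram} {r : ℕ} {c : ℕ × ℕ} :
    c ∈ (rectComplement lam r).cells ↔ (c.1 < r ∧ c.2 < lam.rowLen 0) ∧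
      (r - 1 - c.1, lam.rowLen 0 - 1 - c.2) ∉ lam := by
  simp [rectComplement]

/-- The boxes of a Young diagram and of its rotated complement make up a rectangle. -/
theorem exists_rectangle_equiv (lam : YoungDiagram) (r : ℕ) (hlam : lam.colLen 0 ≤ r) :
    ∃ pos : lam.cells ⊕ (rectComplement lam r).cells ≃ Fin r × Fin (lam.rowLen 0),
      (∀ c : lam.cells, ((pos (Sum.inl c)).1 : ℕ) = c.1.1 ∧ ((pos (Sum.inl c)).2 : ℕ) = c.1.2) ∧
      ∀ c : (rectComplement lam r).cells, ((pos (Sum.inr c)).1 : ℕ) = r - 1 - c.1.1 ∧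
        ((pos (Sum.inr c)).2 : ℕ) = lam.rowLen 0 - 1 - c.1.2 := by
  have hl : ∀ c : lam.cells, c.1.1 < r ∧ c.1.2 < lam.rowLen 0 := fun c =>
    lt_of_mem_of_colLen_le hlam ((lam.mem_cells _).1 c.2)
  have hr : ∀ c : (rectComplement lam r).cells, c.1.1 < r ∧ c.1.2 < lam.rowLen 0 := fun c =>
    (mem_rectComplement.1 c.2).1
  -- The half turn that made the complement a diagram is undone here. Subtraction does not truncate,
  -- since all boxes lie inside the rectangle.
  let f : lam.cells ⊕ (rectComplement lam r).cells → Fin r × Fin (lam.rowLen 0) :=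
    Sum.elim (fun c => (⟨c.1.1, (hl c).1⟩, ⟨c.1.2, (hl c).2⟩))
      fun c => (⟨r - 1 - c.1.1, by have := (hr c).1; omega⟩,
        ⟨lam.rowLen 0 - 1 - c.1.2, by have := (hr c).2; omega⟩)
  have hf : Function.Bijective f := by
    constructor
    · rintro (c | c) (c' | c') h
      · have h1 := congrArg (fun x => (x.1 : ℕ)) h
        have h2 := congrArg (fun x => (x.2 : ℕ)) h
        simp only [f, Sum.elim_inl] at h1 h2
        rw [Subtype.ext (Prod.ext h1 h2)]
      · exfalso
        have h1 := congrArg (fun x => (x.1 : ℕ)) h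
        have h2 := congrArg (fun x => (x.2 : ℕ)) h
        simp only [f, Sum.elim_inl, Sum.elim_inr] at h1 h2
        refine (mem_rectComplement.1 c'.2).2 ?_
        rw [← h1, ← h2]
        exact (lam.mem_cells _).1 c.2
      · exfalso
        have h1 := congrArg (fun x => (x.1 : ℕ)) h
        have h2 := congrArg (fun x => (x.2 : ℕ)) h
        simp only [f, Sum.elim_inl, Sum.elim_inr] at h1 h2
        refine (mem_rectComplement.1 c.2).2 ?_
        rw [h1, h2]
        exact (lam.mem_cells _).1 c'.2
      · have h1 := congrArg (fun x => (x.1 : ℕ)) h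
        have h2 := congrArg (fun x => (x.2 : ℕ)) h
        simp only [f, Sum.elim_inr] at h1 h2
        have := hr c
        have := hr c'
        rw [Subtype.ext (Prod.ext (by omega) (by omega) : c.1 = c'.1)]
    · rintro ⟨⟨i, hi⟩, ⟨j, hj⟩⟩
      by_cases h : (i, j) ∈ lam
      · exact ⟨Sum.inl ⟨(i, j), (lam.mem_cells _).2 h⟩, rfl⟩
      · have hi' : r - 1 - (r - 1 - i) = i := by omega
        have hj' : lam.rowLen 0 - 1 - (lam.rowLen 0 - 1 - j) = j := by omega
        refine ⟨Sum.inr ⟨(r - 1 - i, lam.rowLen 0 - 1 - j), mem_rectComplement.2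
          ⟨⟨by omega, by omega⟩, by rwa [hi', hj']⟩⟩, ?_⟩
        simp only [f, Sum.elim_inr, hi', hj']
  exact ⟨Equiv.ofBijective f hf, fun c => ⟨rfl, rfl⟩, fun c => ⟨rfl, rfl⟩⟩

theorem coe_schurCongr {K : Type u} [Field K] (lam : YoungDiagram) {M N : Type*}
    [AddCommGroup M] [Module K M] [AddCommGroup N] [Module K N] (e : M ≃ₗ[K] N)
    (x : schurSpace K lam M) :
    (schurCongr K lam e x : ⨂[K] _ : lam.cells, N) =
      PiTensorProduct.map (fun _ => e.toLinearMap) (x : ⨂[K] _ : lam.cells, M) := rfl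

/-- If the boxes of two Young diagrams make up a rectangle, then the Schur functor of the first and
the Schur functor of the second applied to the dual are isomorphic up to a power of the
determinant. -/
theorem exists_schurSpace_equiv_dual_of_rectangle (K : Type u) [Field K] [CharZero K]
    (lam alpha : YoungDiagram) {r N : ℕ} (pos : lam.cells ⊕ alpha.cells ≃ Fin r × Fin N)
    (hrow : ∀ c d : lam.cells, c.1.1 = d.1.1 ↔ (pos (Sum.inl c)).1 = (pos (Sum.inl d)).1)
    (hcol : ∀ c d : lam.cells, c.1.2 = d.1.2 ↔ (pos (Sum.inl c)).2 = (pos (Sum.inl d)).2)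
    (hrow' : ∀ c d : alpha.cells, c.1.1 = d.1.1 ↔ (pos (Sum.inr c)).1 = (pos (Sum.inr d)).1)
    (hcol' : ∀ c d : alpha.cells, c.1.2 = d.1.2 ↔ (pos (Sum.inr c)).2 = (pos (Sum.inr d)).2) :
    ∃ F : schurSpace K lam (Fin r → K) ≃ₗ[K]
        schurSpace K alpha (Module.Dual K (Fin r → K)),
      ∀ (g : (Fin r → K) ≃ₗ[K] (Fin r → K)) (x : schurSpace K lam (Fin r → K)),
        F (schurCongr K lam g x) = LinearMap.det g.toLinearMap ^ N •
          schurCongr K alpha g.symm.dualMap (F x) := by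
  let row : lam.cells → Fin r := fun c => (pos (Sum.inl c)).1
  let col : lam.cells → Fin N := fun c => (pos (Sum.inl c)).2
  let row' : alpha.cells → Fin r := fun c => (pos (Sum.inr c)).1
  let col' : alpha.cells → Fin N := fun c => (pos (Sum.inr c)).2
  have hA : rowSymmetrizer K lam = fiberSymmetrizer K row := by
    rw [rowSymmetrizer_eq]
    exact fiberSymmetrizer_congr K hrow
  have hB : colAntisymmetrizer K lam = fiberAntisymmetrizer K col := by
    rw [colAntisymmetrizer_eq]
    exact fiberAntisymmetrizer_congr K hcol
  have hA' : rowSymmetrizer K alpha = fiberSymmetrizer K row' := by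
    rw [rowSymmetrizer_eq]
    exact fiberSymmetrizer_congr K hrow'
  have hB' : colAntisymmetrizer K alpha = fiberAntisymmetrizer K col' := by
    rw [colAntisymmetrizer_eq]
    exact fiberAntisymmetrizer_congr K hcol'
  have hy : youngSymmetrizer K lam = fiberSymmetrizer K row * fiberAntisymmetrizer K col := by
    rw [youngSymmetrizer, hA, hB]
  have hy' : youngSymmetrizer K alpha =
      fiberSymmetrizer K row' * fiberAntisymmetrizer K col' := by
    rw [youngSymmetrizer, hA', hB']
  let b := Pi.basisFun K (Fin r)
  -- The test fillings `row` and `row'` put into each box its row in the rectangle. Together they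
  -- are the identity on every column, so the kernel takes the value 1 there.
  obtain ⟨F₀, hF₀⟩ := exists_range_equiv (K := K) b b.dualBasis (d := detKernel pos)
    (row := row) (col := col) (row' := row') (col' := col') (p₀ := row) (q₀ := row')
    (detKernel_comp_left pos)
    (fun σ hσ p q => by
      rw [← detKernel_sumComm pos, ← detKernel_sumComm pos]
      exact detKernel_comp_left ((Equiv.sumComm _ _).trans pos) σ hσ q p)
    (exists_sum_detKernel_mul pos)
    (fun σ => by
      simp only [← detKernel_sumComm pos]
      exact exists_sum_detKernel_mul _ σ)
    (fun σ hσ => funext hσ) (fun σ hσ => funext hσ)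
    (by
      have : Sum.elim row row' ∘ pos.symm = Prod.fst := by
        funext c
        obtain ⟨x, rfl⟩ := pos.surjective c
        rcases x with x | x <;> simp [row, row']
      rw [detKernel, this, columnDet_fst]
      exact one_ne_zero)
    (fun x => by
      rw [← hy, ← hA, ← hB]
      exact exists_rowSymmetrizer_mul_mul lam x)
    (fun x => by
      rw [← hy', ← hA', ← hB']
      exact exists_rowSymmetrizer_mul_mul alpha x)
    hy hy' (exists_youngSymmetrizer_mul_self lam) (exists_youngSymmetrizer_mul_self alpha)
  let F : schurSpace K lam (Fin r → K) ≃ₗ[K]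
    schurSpace K alpha (Module.Dual K (Fin r → K)) := F₀
  have hF : ∀ x : schurSpace K lam (Fin r → K),
      (F x : ⨂[K] _ : alpha.cells, Module.Dual K (Fin r → K)) =
        (permRep K alpha.cells (Module.Dual K (Fin r → K))).asAlgebraHom
          (fiberSymmetrizer K row') (kernelMap b b.dualBasis (detKernel pos) x) := hF₀
  refine ⟨F, fun g x => ?_⟩
  -- The equivariance is checked after applying the transpose of `g`, which cancels the inverse
  -- transpose on the right.
  have hinj : Function.Injective
      (PiTensorProduct.map (R := K) fun _ : alpha.cells => g.toLinearMap.dualMap) :=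
    (PiTensorProduct.congr fun _ : alpha.cells => g.dualMap).injective
  have hcancel : ∀ t, PiTensorProduct.map (R := K)
      (fun _ : alpha.cells => g.toLinearMap.dualMap)
      (PiTensorProduct.map (fun _ => g.symm.dualMap.toLinearMap) t) = t := by
    intro t
    rw [← LinearMap.comp_apply, ← PiTensorProduct.map_comp]
    have : g.toLinearMap.dualMap ∘ₗ g.symm.dualMap.toLinearMap = LinearMap.id :=
      LinearMap.ext fun φ => LinearMap.ext fun v => congrArg φ (g.symm_apply_apply v)
    rw [this, PiTensorProduct.map_id, LinearMap.id_apply]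
  refine Subtype.ext (hinj ?_)
  rw [Submodule.coe_smul, map_smul, coe_schurCongr, hcancel, hF, hF, coe_schurCongr,
    map_asAlgebraHom, map_dualMap_kernelMap, map_smul, Fintype.card_fin]

/-- The Schur functor of `lam` and the Schur functor of its rotated complement applied to the dual
are isomorphic up to a power of the determinant. -/
theorem exists_schurSpace_equiv_dual (K : Type u) [Field K] [CharZero K] (lam : YoungDiagram)
    (r : ℕ) (hlam : lam.colLen 0 ≤ r) :
    ∃ F : schurSpace K lam (Fin r → K) ≃ₗ[K]
        schurSpace K (rectComplement lam r) (Module.Dual K (Fin r → K)),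
      ∀ (g : (Fin r → K) ≃ₗ[K] (Fin r → K)) (x : schurSpace K lam (Fin r → K)),
        F (schurCongr K lam g x) = LinearMap.det g.toLinearMap ^ lam.rowLen 0 •
          schurCongr K (rectComplement lam r) g.symm.dualMap (F x) := by
  obtain ⟨pos, hpos, hpos'⟩ := exists_rectangle_equiv lam r hlam
  have hr : ∀ c : (rectComplement lam r).cells, c.1.1 < r ∧ c.1.2 < lam.rowLen 0 := fun c =>
    (mem_rectComplement.1 c.2).1
  refine exists_schurSpace_equiv_dual_of_rectangle K lam _ pos
    (fun c d => ?_) (fun c d => ?_) (fun c d => ?_) (fun c d => ?_)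
  · rw [Fin.ext_iff, (hpos c).1, (hpos d).1]
  · rw [Fin.ext_iff, (hpos c).2, (hpos d).2]
  -- Reflection separates rows only because both indices are below `r`; beyond that the subtraction
  -- would truncate.
  · have := hr c
    have := hr d
    rw [Fin.ext_iff, (hpos' c).1, (hpos' d).1]
    omega
  · have := hr c
    have := hr d
    rw [Fin.ext_iff, (hpos' c).2, (hpos' d).2]
    omega

end Duality

/-! ### Isomorphisms of bundles with compatible transition maps -/

section Bundles

variable {K : Type u} {X : Type v} [Field K] [TopologicalSpace X] [SpaceWithFunctions K X]

open SpaceWithFunctions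

/-- Expanding `f x` in a fixed basis of `M` makes the value a sum of products of regular functions.
This is how composites of transition maps are seen to be regular. -/
theorem regular_linearMap_apply {U : Opens X} {M N : Type*} [AddCommGroup M] [Module K M]
    [Module.Finite K M] [AddCommGroup N] [Module K N] (f : U → M) (A : U → M →ₗ[K] N)
    (ξ : Module.Dual K N)
    (hf : ∀ η : Module.Dual K M, (fun x => η (f x)) ∈ regular (K := K) U)
    (hA : ∀ m : M, (fun x => ξ (A x m)) ∈ regular (K := K) U) :
    (fun x => ξ (A x (f x))) ∈ regular (K := K) U := by
  let b := Module.finBasis K M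
  have key : (fun x => ξ (A x (f x))) =
      ∑ i, (fun x => b.coord i (f x)) * fun x => ξ (A x (b i)) := by
    funext x
    have h : ξ (A x (f x)) = ξ (A x (∑ i, b.coord i (f x) • b i)) :=
      congrArg (fun m => ξ (A x m)) (b.sum_repr (f x)).symm
    rw [h]
    simp only [map_sum, map_smul, Finset.sum_apply, Pi.mul_apply, smul_eq_mul]
  rw [key]
  exact Subalgebra.sum_mem _ fun i _ => Subalgebra.mul_mem _ (hf _) (hA _)

/-- An isomorphism of the typical fibres of two bundles that commutes with the transition maps of
common trivializations over an open cover induces an isomorphism of bundles. -/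
theorem AlgVectorBundle.nonempty_iso_of_model (E F : AlgVectorBundle K X) {I : Type*}
    (s : I → E.Index) (t : I → F.Index)
    (hcov : ∀ x, ∃ i, x ∈ E.base (s i) ∧ x ∈ F.base (t i)) (φ : E.Model ≃ₗ[K] F.Model)
    (hφ : ∀ (i j : I) (x : X) (hi : x ∈ E.base (s i)) (hi' : x ∈ F.base (t i))
      (hj : x ∈ E.base (s j)) (hj' : x ∈ F.base (t j)) (m : E.Model),
      φ (E.triv (s j) x hj ((E.triv (s i) x hi).symm m)) =
        F.triv (t j) x hj' ((F.triv (t i) x hi').symm (φ m))) :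
    Nonempty (AlgVectorBundle.Iso E F) := by
  choose c hc hc' using hcov
  let e : ∀ x, E.Fiber x ≃ₗ[K] F.Fiber x := fun x =>
    (E.triv (s (c x)) x (hc x)).trans (φ.trans (F.triv (t (c x)) x (hc' x)).symm)
  -- Compatibility with transition maps makes the fibre map independent of the chart chosen at the
  -- point.
  have he : ∀ (x : X) (i : I) (hi : x ∈ E.base (s i)) (hi' : x ∈ F.base (t i))
      (y : E.Fiber x), F.triv (t i) x hi' (e x y) = φ (E.triv (s i) x hi y) := by
    intro x i hi hi' y
    have := hφ (c x) i x (hc x) (hc' x) hi hi' (E.triv (s (c x)) x (hc x) y)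
    rw [LinearEquiv.symm_apply_apply] at this
    exact this.symm
  refine ⟨⟨e, fun i j m ξ => glue fun x => ?_, fun i j m ξ => glue fun x => ?_⟩⟩
  · have hx := hc x.1
    have hx' := hc' x.1
    -- The choice `c` need not be locally constant; the chart chosen at `x` is kept fixed on a whole
    -- neighbourhood.
    generalize c x.1 = l at hx hx'
    refine ⟨(E.base i ⊓ F.base j) ⊓ (E.base (s l) ⊓ F.base (t l)), inf_le_left,
      ⟨x.2, hx, hx'⟩, ?_⟩
    -- Near `x` the map is the transition of `E` from `i` to `l`, then `φ`, then the transition of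
    -- `F` from `l` to `j`.
    have h := regular_linearMap_apply (K := K)
      (U := (E.base i ⊓ F.base j) ⊓ (E.base (s l) ⊓ F.base (t l)))
      (fun y => φ (E.triv (s l) y.1 y.2.2.1 ((E.triv i y.1 y.2.1.1).symm m)))
      (fun y => (F.triv j y.1 y.2.1.2).toLinearMap ∘ₗ
        (F.triv (t l) y.1 y.2.2.2).symm.toLinearMap) ξ
      (fun η => restrict (U := E.base i ⊓ E.base (s l))
        (W := (E.base i ⊓ F.base j) ⊓ (E.base (s l) ⊓ F.base (t l))) (fun y hy => ⟨hy.1.1, hy.2.1⟩)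
        (E.regular_transition i (s l) m (η ∘ₗ φ.toLinearMap)))
      (fun m' => restrict (U := F.base (t l) ⊓ F.base j)
        (W := (E.base i ⊓ F.base j) ⊓ (E.base (s l) ⊓ F.base (t l))) (fun y hy => ⟨hy.2.2, hy.1.2⟩)
        (F.regular_transition (t l) j m' ξ))
    convert h using 3 with y
    rw [LinearMap.comp_apply, LinearEquiv.coe_coe, LinearEquiv.coe_coe,
      ← he y.1 l y.2.2.1 y.2.2.2, LinearEquiv.symm_apply_apply]
  · have hx := hc x.1
    have hx' := hc' x.1
    generalize c x.1 = l at hx hx'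
    refine ⟨(E.base i ⊓ F.base j) ⊓ (E.base (s l) ⊓ F.base (t l)), inf_le_left,
      ⟨x.2, hx, hx'⟩, ?_⟩
    have h := regular_linearMap_apply (K := K)
      (U := (E.base i ⊓ F.base j) ⊓ (E.base (s l) ⊓ F.base (t l)))
      (fun y => φ.symm (F.triv (t l) y.1 y.2.2.2 ((F.triv j y.1 y.2.1.2).symm m)))
      (fun y => (E.triv i y.1 y.2.1.1).toLinearMap ∘ₗ
        (E.triv (s l) y.1 y.2.2.1).symm.toLinearMap) ξ
      (fun η => restrict (U := F.base j ⊓ F.base (t l))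
        (W := (E.base i ⊓ F.base j) ⊓ (E.base (s l) ⊓ F.base (t l))) (fun y hy => ⟨hy.1.2, hy.2.2⟩)
        (F.regular_transition j (t l) m (η ∘ₗ φ.symm.toLinearMap)))
      (fun m' => restrict (U := E.base (s l) ⊓ E.base i)
        (W := (E.base i ⊓ F.base j) ⊓ (E.base (s l) ⊓ F.base (t l))) (fun y hy => ⟨hy.2.1, hy.1.1⟩)
        (E.regular_transition (s l) i m' ξ))
    convert h using 3 with y
    have hinv : ∀ z, (e y.1).symm z = (E.triv (s l) y.1 y.2.2.1).symm
        (φ.symm (F.triv (t l) y.1 y.2.2.2 z)) := by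
      intro z
      rw [LinearEquiv.symm_apply_eq]
      apply (F.triv (t l) y.1 y.2.2.2).injective
      rw [he y.1 l y.2.2.1 y.2.2.2, LinearEquiv.apply_symm_apply, LinearEquiv.apply_symm_apply]
    rw [LinearMap.comp_apply, LinearEquiv.coe_coe, LinearEquiv.coe_coe, hinv]

end Bundles

/-! ### Transition maps on the Grassmannian -/

theorem schurCongr_schurCongr {K : Type u} [Field K] (lam : YoungDiagram) {M N P : Type*}
    [AddCommGroup M] [Module K M] [AddCommGroup N] [Module K N] [AddCommGroup P] [Module K P]
    (e : M ≃ₗ[K] N) (e' : N ≃ₗ[K] P) (x : schurSpace K lam M) :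
    schurCongr K lam e' (schurCongr K lam e x) = schurCongr K lam (e.trans e') x := by
  apply Subtype.ext
  rw [coe_schurCongr, coe_schurCongr, coe_schurCongr, ← LinearMap.comp_apply,
    ← PiTensorProduct.map_comp]
  rfl

theorem schurCongr_schurCongr_symm {K : Type u} [Field K] (lam : YoungDiagram) {M N P : Type*}
    [AddCommGroup M] [Module K M] [AddCommGroup N] [Module K N] [AddCommGroup P] [Module K P]
    (e : M ≃ₗ[K] N) (e' : M ≃ₗ[K] P) (x : schurSpace K lam N) :
    schurCongr K lam e' ((schurCongr K lam e).symm x) =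
      schurCongr K lam (e.symm.trans e') x := by
  obtain ⟨y, rfl⟩ := (schurCongr K lam e).surjective x
  rw [LinearEquiv.symm_apply_apply, schurCongr_schurCongr, ← LinearEquiv.trans_assoc,
    LinearEquiv.self_trans_symm, LinearEquiv.refl_trans]

theorem congr_congr_symm_eq_smul {K : Type u} [Field K] {ι : Type*} [Fintype ι] {M N : Type*}
    [AddCommGroup M] [Module K M] [AddCommGroup N] [Module K N] (e e' : M ≃ₗ[K] N) {r : K}
    (h : ∀ m, e' (e.symm m) = r • m) (t : ⨂[K] _ : ι, N) :
    (PiTensorProduct.congr fun _ : ι => e') ((PiTensorProduct.congr fun _ : ι => e).symm t) =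
      r ^ Fintype.card ι • t := by
  induction t using PiTensorProduct.induction_on with
  | smul_tprod c a =>
    rw [map_smul, map_smul, PiTensorProduct.congr_symm_tprod, PiTensorProduct.congr_tprod,
      smul_comm]
    congr 1
    simp only [h]
    rw [MultilinearMap.map_smul_univ, Finset.prod_const, Finset.card_univ]
  | add a b ha hb => rw [map_add, map_add, ha, hb, smul_add]

namespace Grassmannian

variable {K : Type u} [Field K] {L : Type v} [AddCommGroup L] [Module K L] {k : ℕ}

/-- In a basis of `Λ` the evaluation matrix has the Plücker coordinate as its determinant, and the
transition matrix times the evaluation of `a` is the evaluation of `b`. -/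
theorem det_evalEquiv_symm_trans (a b : Fin (k + 1) → Module.Dual K L) (Λ : Grassmannian K L k)
    (ha : Λ ∈ formOpen (coordForm a)) (hb : Λ ∈ formOpen (coordForm b)) :
    LinearMap.det ((evalEquiv a Λ ha).symm.trans (evalEquiv b Λ hb)).toLinearMap *
      coordForm a Λ.pluckerVector = coordForm b Λ.pluckerVector := by
  rw [← det_evalMap, ← det_evalMap, ← LinearMap.det_toMatrix (Pi.basisFun K (Fin (k + 1))),
    ← Matrix.det_mul, ← LinearMap.toMatrix_comp]
  congr 2
  refine LinearMap.ext fun l => ?_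
  change evalEquiv b Λ hb ((evalEquiv a Λ ha).symm (evalEquiv a Λ ha l)) = evalEquiv b Λ hb l
  rw [LinearEquiv.symm_apply_apply]

/-- The tautological line changes by `η / ξ` from chart `ξ` to chart `η`; dualizing inverts the
factor. -/
theorem tautLine_dual_transition (ξ η : Module.Dual K (PluckerSpace K L k))
    (Λ : Grassmannian K L k) (hξ : Λ ∈ formOpen ξ) (hη : Λ ∈ formOpen η)
    (m : Module.Dual K K) :
    (lineEquiv η Λ hη).symm.dualMap ((lineEquiv ξ Λ hξ).symm.dualMap.symm m) =
      (ξ Λ.pluckerVector / η Λ.pluckerVector) • m := by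
  refine LinearMap.ext fun y => ?_
  change m (lineEquiv ξ Λ hξ ((lineEquiv η Λ hη).symm y)) = _
  have h : ξ ((y / η Λ.pluckerVector) • Λ.pluckerVector) =
      (ξ Λ.pluckerVector / η Λ.pluckerVector) • y := by
    rw [map_smul, smul_eq_mul, smul_eq_mul]
    ring
  rw [lineEquiv_apply, lineEquiv_symm_apply, h, map_smul]
  rfl

end Grassmannian

/-- A tensor power of the dual of the base field is a line. -/
def dualTensorPowerEquiv (K : Type u) [Field K] (d : ℕ) :
    (⨂[K] _ : Fin d, Module.Dual K K) ≃ₗ[K] K :=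
  (PiTensorProduct.congr fun _ : Fin d => LinearMap.ringLmapEquivSelf K K K).trans
    (PiTensorProduct.constantBaseRingEquiv (Fin d) K).toLinearEquiv

/-- Compatibility of an isomorphism `S ⊗ L ≃ S'` with transition maps, for a line `L`. -/
theorem congr_trans_rid_transition {K : Type*} [Field K] {S S₁ S' S'₁ L L₁ : Type*}
    [AddCommGroup S] [Module K S] [AddCommGroup S₁] [Module K S₁] [AddCommGroup S'] [Module K S']
    [AddCommGroup S'₁] [Module K S'₁] [AddCommGroup L] [Module K L] [AddCommGroup L₁]
    [Module K L₁] (F : S ≃ₗ[K] S') (ε : L ≃ₗ[K] K) (eS fS : S₁ ≃ₗ[K] S) (eL fL : L₁ ≃ₗ[K] L)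
    (eS' fS' : S'₁ ≃ₗ[K] S') (r : K) (hL : ∀ l, fL (eL.symm l) = r • l)
    (hS : ∀ x, r • F (fS (eS.symm x)) = fS' (eS'.symm (F x))) (m : S ⊗[K] L) :
    ((TensorProduct.congr F ε).trans (TensorProduct.rid K S'))
        ((TensorProduct.congr fS fL) ((TensorProduct.congr eS eL).symm m)) =
      fS' (eS'.symm (((TensorProduct.congr F ε).trans (TensorProduct.rid K S')) m)) := by
  induction m using TensorProduct.induction_on with
  | zero => simp only [map_zero]
  | add x y hx hy => simp only [map_add, hx, hy]
  | tmul x l =>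
    rw [TensorProduct.congr_symm_tmul, TensorProduct.congr_tmul, hL, LinearEquiv.trans_apply,
      LinearEquiv.trans_apply, TensorProduct.congr_tmul, TensorProduct.congr_tmul,
      TensorProduct.rid_tmul, TensorProduct.rid_tmul, map_smul, map_smul, map_smul, smul_eq_mul,
      mul_comm, mul_smul, hS]

/-- Here `φ` may fail to commute with transition maps, by exactly the scalar cocycle `r` of the line
bundle `N`; the tensor product with `N` absorbs the failure. -/
theorem AlgVectorBundle.nonempty_iso_tensor_of_model {K : Type u} {X : Type v} [Field K]
    [TopologicalSpace X] [SpaceWithFunctions K X] (E N F : AlgVectorBundle K X) {I : Type*}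
    (s : I → E.Index) (s' : I → N.Index) (t : I → F.Index)
    (hcov : ∀ x, ∃ i, x ∈ E.base (s i) ∧ x ∈ N.base (s' i) ∧ x ∈ F.base (t i))
    (φ : E.Model ≃ₗ[K] F.Model) (ε : N.Model ≃ₗ[K] K) (r : I → I → X → K)
    (hN : ∀ (i j : I) (x : X) (hi : x ∈ N.base (s' i)) (hj : x ∈ N.base (s' j)) (l : N.Model),
      N.triv (s' j) x hj ((N.triv (s' i) x hi).symm l) = r i j x • l)
    (hφ : ∀ (i j : I) (x : X) (hi : x ∈ E.base (s i)) (hi' : x ∈ F.base (t i))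
      (hj : x ∈ E.base (s j)) (hj' : x ∈ F.base (t j)) (m : E.Model),
      r i j x • φ (E.triv (s j) x hj ((E.triv (s i) x hi).symm m)) =
        F.triv (t j) x hj' ((F.triv (t i) x hi').symm (φ m))) :
    Nonempty (AlgVectorBundle.Iso (E.tensor N) F) := by
  refine AlgVectorBundle.nonempty_iso_of_model (E.tensor N) F (fun i => (s i, s' i)) t
    (fun x => ?_) ((TensorProduct.congr φ ε).trans (TensorProduct.rid K _))
    fun i j x hi hi' hj hj' m => ?_
  · obtain ⟨i, h₁, h₂, h₃⟩ := hcov x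
    exact ⟨i, ⟨h₁, h₂⟩, h₃⟩
  · exact congr_trans_rid_transition φ ε (E.triv (s i) x hi.1) (E.triv (s j) x hj.1)
      (N.triv (s' i) x hi.2) (N.triv (s' j) x hj.2) (F.triv (t i) x hi') (F.triv (t j) x hj')
      (r i j x) (hN i j x hi.2 hj.2) (hφ i j x hi.1 hi' hj.1 hj') m

/-- The twisted Schur functor of the universal subbundle is the Schur functor of the rotated
complement applied to the dual bundle. -/
theorem nonempty_iso_schur_universalSub_twist {K : Type u} [Field K] [CharZero K]
    (L : Type v) [AddCommGroup L] [Module K L] (k : ℕ) (lam : YoungDiagram)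
    (hlam : lam.colLen 0 ≤ k + 1) :
    Nonempty (AlgVectorBundle.Iso
      (((Grassmannian.universalSub K L k).schur lam).twist (lam.rowLen 0))
      ((Grassmannian.universalQuot K L k).schur (rectComplement lam (k + 1)))) := by
  obtain ⟨F, hF⟩ := exists_schurSpace_equiv_dual K lam (k + 1) hlam
  have key : ∀ (a b : Fin (k + 1) → Module.Dual K L) (Λ : Grassmannian K L k)
      (ha : Λ ∈ Grassmannian.formOpen (Grassmannian.coordForm a))
      (hb : Λ ∈ Grassmannian.formOpen (Grassmannian.coordForm b))
      (x : schurSpace K lam (Fin (k + 1) → K)),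
      (Grassmannian.coordForm a Λ.pluckerVector / Grassmannian.coordForm b Λ.pluckerVector) ^
          Fintype.card (Fin (lam.rowLen 0)) •
        F (schurCongr K lam (Grassmannian.evalEquiv b Λ hb)
          ((schurCongr K lam (Grassmannian.evalEquiv a Λ ha)).symm x)) =
      schurCongr K (rectComplement lam (k + 1)) (Grassmannian.evalEquiv b Λ hb).symm.dualMap
        ((schurCongr K (rectComplement lam (k + 1))
          (Grassmannian.evalEquiv a Λ ha).symm.dualMap).symm (F x)) := by
    intro a b Λ ha hb x
    -- The cocycle of 𝒪(1) is inverse to the determinant of the transition matrix; raised to the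
    -- power λ₁, the two cancel.
    have hone : (Grassmannian.coordForm a Λ.pluckerVector /
        Grassmannian.coordForm b Λ.pluckerVector) *
        LinearMap.det ((Grassmannian.evalEquiv a Λ ha).symm.trans
          (Grassmannian.evalEquiv b Λ hb)).toLinearMap = 1 := by
      rw [div_mul_eq_mul_div, mul_comm, Grassmannian.det_evalEquiv_symm_trans a b Λ ha hb,
        div_self (Grassmannian.mem_formOpen.1 hb)]
    rw [schurCongr_schurCongr_symm, hF, schurCongr_schurCongr_symm, Fintype.card_fin, smul_smul,
      ← mul_pow, hone, one_pow, one_smul]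
    rfl
  -- Charts of 𝒪(1) given by arbitrary linear forms are not needed: for the form `coordForm a` all
  -- three bundles are trivialized on the same open set.
  refine AlgVectorBundle.nonempty_iso_tensor_of_model
    ((Grassmannian.universalSub K L k).schur lam)
    (Grassmannian.twistingLine K L k (lam.rowLen 0))
    ((Grassmannian.universalQuot K L k).schur (rectComplement lam (k + 1)))
    (I := Fin (k + 1) → Module.Dual K L)
    (fun a => a) (fun a => Grassmannian.coordForm a) (fun a => a) (fun Λ => ?_)
    F (dualTensorPowerEquiv K (lam.rowLen 0))
    (fun a b Λ => (Grassmannian.coordForm a Λ.pluckerVector /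
        Grassmannian.coordForm b Λ.pluckerVector) ^ Fintype.card (Fin (lam.rowLen 0)))
    (fun a b Λ ha hb => congr_congr_symm_eq_smul _ _
      (Grassmannian.tautLine_dual_transition _ _ Λ ha hb))
    (fun a b Λ ha _ hb _ x => key a b Λ ha hb x)
  obtain ⟨a, ha⟩ := Λ.exists_coordForm_ne_zero
  exact ⟨a, ha, ha, ha⟩

end

end GrassSchur

theorem proposition5 {K : Type u} [Field K] [IsAlgClosed K] [CharZero K]
    {V : Type v} [AddCommGroup V] [Module K V] (k n : ℕ) (hV : Module.finrank K V = n + 1)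
    (lam : YoungDiagram) (hlam : lam.colLen 0 ≤ k + 1) :
    Nonempty (GrassSchur.AlgVectorBundle.Iso
      (((GrassSchur.Grassmannian.universalSub K (Module.Dual K V) k).schur lam).twist (lam.rowLen 0))
      ((GrassSchur.Grassmannian.universalQuot K (Module.Dual K V) k).schur
        (GrassSchur.rectComplement lam (k + 1)))) := by
  exact GrassSchur.nonempty_iso_schur_universalSub_twist _ k lam hlam
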